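/- Let $\mathfrak o$ be a compact discrete valuation ring of characteristic $2$ with maximal ideal $\wp$ and uniformizer $\pi$, let $r\ge 2$, $\ell=\lceil r/2\rceil$, $\ell'=\lfloor r/2\rfloor$, and write $\mathfrak o_i=\mathfrak o/\wp^i$. Let $\psi:\mathfrak o_r\to\mathbb C^\times$ be an additive character with $\psi(\pi^{r-1})\neq 1$. Let $M^\ell=I+\pi^\ell M_2(\mathfrak o_r)\le \mathrm{GL}_2(\mathfrak o_r)$, and for $A\in M_2(\mathfrak o_{\ell'})$ let $\psi_A:M^\ell\to\mathbb C^\times$ be the one-dimensional representation $\psi_A(I+\pi^\ell B)=\psi(\pi^\ell\,\mathrm{trace}(\tilde A B))$, where $\tilde A\in M_2(\mathfrak o_r)$ is any lift of $A$. Call $\psi$ normalized if $\psi(y^2)=1$ for every $y\in\mathfrak o_r$ with $y^2\in\pi^{\ell'}\mathfrak o_r$. If $r$ is even, normalized characters $\psi$ with $\psi(\pi^{r-1})\ne1$ exist. Let $A\in M_2(\mathfrak o_{\ell'})$ be cyclic (that is, $\{v,Av\}$ generates $\mathfrak o_{\ell'}\oplus\mathfrak o_{\ell'}$ for some vector $v$)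 with $\mathrm{trace}(A)\in\mathfrak o_{\ell'}^\times$, and let $\rho$ be a complex irreducible representation of $\mathrm{GL}_2(\mathfrak o_r)$ that is a constituent of $\mathrm{Ind}_{M^\ell}^{\mathrm{GL}_2(\mathfrak o_r)}(\psi_A)$. Then: 1. If $r$ is odd, the restriction of $\rho$ to $\mathrm{SL}_2(\mathfrak o_r)$ is irreducible. 2. If $r$ is even, $\psi$ is normalized, and $\mathrm{trace}(A)$ is not a square in $\mathfrak o_{\ell'}$, the restriction of $\rho$ to $\mathrm{SL}_2(\mathfrak o_r)$ is irreducible. 3. If $r$ is even and $\mathrm{trace}(A)$ is a square in $\mathfrak o_{\ell'}$, the restriction of $\rho$ to $\mathrm{SL}_2(\mathfrak o_r)$ is either irreducible or a direct sum of two irreducible representations, each of dimension $\dim(\rho)/2$. -/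

import Mathlib

open Matrix IsLocalRing

/-- A square matrix `A` of size two is cyclic if `{v, A v}` generates `R ⊕ R` for some vector `v`.
(Two generators of a free module of rank two over a commutative ring always form a basis.) -/
def IsCyclicMatrix {R : Type*} [CommRing R] (A : Matrix (Fin 2) (Fin 2) R) : Prop :=
  ∃ v : Fin 2 → R, Submodule.span R {v, A *ᵥ v} = ⊤

/-- The finite quotient `𝔬_r = 𝔬 / ℘ ^ r` of a local ring `𝔬` with maximal ideal `℘`. -/
abbrev QuotPow (𝔬 : Type*) [CommRing 𝔬] [IsLocalRing 𝔬] (r : ℕ) : Type _ :=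
  𝔬 ⧸ (maximalIdeal 𝔬) ^ r

/-- The image of `x : 𝔬` in `𝔬_r`. -/
abbrev toQuotPow {𝔬 : Type*} [CommRing 𝔬] [IsLocalRing 𝔬] (r : ℕ) (x : 𝔬) : QuotPow 𝔬 r :=
  Ideal.Quotient.mk ((maximalIdeal 𝔬) ^ r) x

/-- The congruence subgroup `I + x M₂(R)` of `GL₂(R)`. -/
def congruenceSubgroup {R : Type*} [CommRing R] (x : R) : Subgroup (GL (Fin 2) R) where
  carrier := {g | ∃ B : Matrix (Fin 2) (Fin 2) R, (g : Matrix (Fin 2) (Fin 2) R) = 1 + x • B}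
  one_mem' := ⟨0, by simp⟩
  mul_mem' := by
    rintro g h ⟨B, hB⟩ ⟨C, hC⟩
    refine ⟨B + C + x • (B * C), ?_⟩
    rw [Units.val_mul, hB, hC]
    simp only [add_mul, mul_add, one_mul, mul_one, smul_mul_assoc, mul_smul_comm, smul_add]
    abel
  inv_mem' := by
    rintro g ⟨B, hB⟩
    refine ⟨-(((g⁻¹ : GL (Fin 2) R) : Matrix (Fin 2) (Fin 2) R) * B), ?_⟩
    have h1 : ((g⁻¹ : GL (Fin 2) R) : Matrix (Fin 2) (Fin 2) R) * (1 + x • B) = 1 := by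
      rw [← hB]; exact Units.inv_mul g
    rw [mul_add, mul_one, mul_smul_comm] at h1
    rw [smul_neg, ← h1]
    abel

/-- The one-dimensional representation on `ℂ` given by a multiplicative character. -/
noncomputable def charRep {G : Type*} [Group G] (χ : G →* ℂ) : Representation ℂ G ℂ :=
  ((Algebra.lmul ℂ ℂ : ℂ →ₐ[ℂ] Module.End ℂ ℂ) : ℂ →* Module.End ℂ ℂ).comp χ

section PsiA

variable {𝔬 : Type*} [CommRing 𝔬] [IsDomain 𝔬] [IsDiscreteValuationRing 𝔬]

/-- The entrywise reduction `M₂(𝔬_r) → M₂(𝔬_{ℓ'})`, where `ℓ' = ⌊r / 2⌋`. -/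
def reduceMatrix (r : ℕ) (B : Matrix (Fin 2) (Fin 2) (QuotPow 𝔬 r)) :
    Matrix (Fin 2) (Fin 2) (QuotPow 𝔬 (r / 2)) :=
  B.map (Ideal.Quotient.factor (Ideal.pow_le_pow_right (Nat.div_le_self r 2)))

/-- A chosen lift to `M₂(𝔬_r)` of a matrix over `𝔬_{ℓ'}`, where `ℓ' = ⌊r / 2⌋`. -/
noncomputable def liftMatrix (r : ℕ) (A : Matrix (Fin 2) (Fin 2) (QuotPow 𝔬 (r / 2))) :
    Matrix (Fin 2) (Fin 2) (QuotPow 𝔬 r) :=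
  A.map fun a => toQuotPow r (Function.surjInv Ideal.Quotient.mk_surjective a)

theorem reduceMatrix_liftMatrix (r : ℕ) (A : Matrix (Fin 2) (Fin 2) (QuotPow 𝔬 (r / 2))) :
    reduceMatrix r (liftMatrix r A) = A := by
  ext i j
  simp only [reduceMatrix, liftMatrix, Matrix.map_apply, Ideal.Quotient.factor_mk]
  exact Function.surjInv_eq Ideal.Quotient.mk_surjective (A i j)

theorem toQuotPow_pow_eq_zero {r n : ℕ} (hn : r ≤ n) {π : 𝔬} (hπ : Irreducible π) :
    (toQuotPow r π) ^ n = 0 := by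
  rw [← map_pow, Ideal.Quotient.eq_zero_iff_mem]
  refine Ideal.pow_le_pow_right hn (Ideal.pow_mem_pow ?_ n)
  exact (mem_maximalIdeal π).2 hπ.not_isUnit

/-- The one-dimensional representation `ψ_A` of `M^ℓ = I + π ^ ℓ M₂(𝔬_r)`, where `ℓ = ⌈r / 2⌉` and
`A ∈ M₂(𝔬_{ℓ'})`: with a lift `Ã` of `A` to `M₂(𝔬_r)`,
`ψ_A (I + π ^ ℓ B) = ψ (trace (Ã (π ^ ℓ B))) = ψ (π ^ ℓ trace (Ã B))`.
It does not depend on the lift, see `psiA_apply`. -/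
noncomputable def psiA (r : ℕ) (π : 𝔬) (hπ : Irreducible π) (ψ : AddChar (QuotPow 𝔬 r) ℂ)
    (A : Matrix (Fin 2) (Fin 2) (QuotPow 𝔬 (r / 2))) :
    congruenceSubgroup (toQuotPow r π ^ ((r + 1) / 2)) →* ℂ where
  toFun g := ψ (trace (liftMatrix r A * (((g : GL (Fin 2) (QuotPow 𝔬 r)) :
    Matrix (Fin 2) (Fin 2) (QuotPow 𝔬 r)) - 1)))
  map_one' := by simp
  map_mul' := by
    rintro ⟨g, B, hB⟩ ⟨h, C, hC⟩
    rw [← AddChar.map_add_eq_mul, ← trace_add, ← mul_add]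
    congr 3
    simp only [Subgroup.coe_mul, Units.val_mul, hB, hC]
    have h0 : toQuotPow r π ^ ((r + 1) / 2) * toQuotPow r π ^ ((r + 1) / 2) = 0 := by
      rw [← pow_add]
      exact toQuotPow_pow_eq_zero (by omega) hπ
    simp only [add_mul, mul_add, one_mul, mul_one, smul_mul_assoc, mul_smul_comm, smul_add, smul_smul,
      h0, zero_smul]
    abel

/-- The defining formula of `ψ_A`, valid for every lift `Ã` of `A`. -/
theorem psiA_apply (r : ℕ) (π : 𝔬) (hπ : Irreducible π) (ψ : AddChar (QuotPow 𝔬 r) ℂ)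
    (A : Matrix (Fin 2) (Fin 2) (QuotPow 𝔬 (r / 2)))
    (A' : Matrix (Fin 2) (Fin 2) (QuotPow 𝔬 r)) (hA' : reduceMatrix r A' = A)
    (g : congruenceSubgroup (toQuotPow r π ^ ((r + 1) / 2)))
    (B : Matrix (Fin 2) (Fin 2) (QuotPow 𝔬 r))
    (hB : ((g : GL (Fin 2) (QuotPow 𝔬 r)) : Matrix (Fin 2) (Fin 2) (QuotPow 𝔬 r)) =
      1 + (toQuotPow r π ^ ((r + 1) / 2)) • B) :
    psiA r π hπ ψ A g = ψ (toQuotPow r π ^ ((r + 1) / 2) * trace (A' * B)) := by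
  have key : ∀ a b : QuotPow 𝔬 r,
      Ideal.Quotient.factor (Ideal.pow_le_pow_right (I := maximalIdeal 𝔬)
        (Nat.div_le_self r 2)) a =
      Ideal.Quotient.factor (Ideal.pow_le_pow_right (I := maximalIdeal 𝔬)
        (Nat.div_le_self r 2)) b →
      toQuotPow r π ^ ((r + 1) / 2) * a = toQuotPow r π ^ ((r + 1) / 2) * b := by
    intro a b hab
    obtain ⟨a, rfl⟩ := Ideal.Quotient.mk_surjective a
    obtain ⟨b, rfl⟩ := Ideal.Quotient.mk_surjective b
    rw [Ideal.Quotient.factor_mk, Ideal.Quotient.factor_mk, Ideal.Quotient.eq] at hab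
    rw [← map_pow, ← map_mul, ← map_mul, Ideal.Quotient.eq, ← mul_sub]
    have h1 : π ^ ((r + 1) / 2) ∈ maximalIdeal 𝔬 ^ ((r + 1) / 2) :=
      Ideal.pow_mem_pow ((mem_maximalIdeal π).2 hπ.not_isUnit) _
    have h2 := Ideal.mul_mem_mul h1 hab
    rw [← pow_add] at h2
    exact Ideal.pow_le_pow_right (by omega) h2
  have hl : toQuotPow r π ^ ((r + 1) / 2) • liftMatrix r A =
      toQuotPow r π ^ ((r + 1) / 2) • A' := by
    ext i j
    refine key _ _ ?_
    have h := (reduceMatrix_liftMatrix r A).trans hA'.symm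
    exact congrFun (congrFun h i) j
  change ψ _ = ψ _
  rw [hB, add_sub_cancel_left, mul_smul_comm, ← smul_mul_assoc, hl, smul_mul_assoc, trace_smul,
    smul_eq_mul]

/-- The additive character `ψ` of `𝔬_r` is normalized: it is trivial on all squares lying in
`π ^ ℓ' 𝔬_r`, where `ℓ' = ⌊r / 2⌋`. -/
def IsNormalizedChar (r : ℕ) (π : 𝔬) (ψ : AddChar (QuotPow 𝔬 r) ℂ) : Prop :=
  ∀ y : QuotPow 𝔬 r, toQuotPow r π ^ (r / 2) ∣ y ^ 2 → ψ (y ^ 2) = 1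

end PsiA

/-- `ρ ∈ Irr(G ∣ φ)`: the representation `ρ` of `G` is an irreducible constituent of the
representation `Ind_H^G φ` induced from the representation `φ` of the subgroup `H`, that is, `ρ` is
irreducible and is isomorphic to a subrepresentation of `Ind_H^G φ`. -/
def IsIrrOver {G : Type*} [Group G] {H : Subgroup G} {W V : Type*} [AddCommGroup W] [Module ℂ W]
    [AddCommGroup V] [Module ℂ V] (φ : Representation ℂ H W) (ρ : Representation ℂ G V) : Prop :=
  ρ.IsIrreducible ∧
    ∃ f : Representation.IntertwiningMap ρ (Representation.ind H.subtype φ), Function.Injective f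

/-- The restriction to `SL₂(R)` of a representation of `GL₂(R)`. -/
def resSL {R : Type*} [CommRing R] {V : Type*} [AddCommGroup V] [Module ℂ V]
    (ρ : Representation ℂ (GL (Fin 2) R) V) :
    Representation ℂ (SpecialLinearGroup (Fin 2) R) V :=
  ρ.comp SpecialLinearGroup.toGL

/-- `ρ` is the (internal) direct sum of two irreducible subrepresentations, each of dimension
`dim ρ / 2`. -/
def IsSumOfTwoIrreduciblesOfHalfDim {G : Type*} [Group G] {V : Type*} [AddCommGroup V] [Module ℂ V]
    (ρ : Representation ℂ G V) : Prop :=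
  ∃ W₁ W₂ : Subrepresentation ρ,
    IsCompl W₁.toSubmodule W₂.toSubmodule ∧
    W₁.toRepresentation.IsIrreducible ∧ W₂.toRepresentation.IsIrreducible ∧
    2 * Module.finrank ℂ W₁.toSubmodule = Module.finrank ℂ V ∧
    2 * Module.finrank ℂ W₂.toSubmodule = Module.finrank ℂ V

/-! ### Twists and the restriction of an irreducible representation to a kernel -/

section RepresentationTheory

variable {G : Type*} [Group G] {V : Type*} [AddCommGroup V] [Module ℂ V]

theorem isIrreducible_iff_forall_submodule {ρ : Representation ℂ G V} :
    ρ.IsIrreducible ↔ Nontrivial V ∧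
      ∀ U : Submodule ℂ V, (∀ g, ∀ v ∈ U, ρ g v ∈ U) → U = ⊥ ∨ U = ⊤ := by
  constructor
  · intro h
    refine ⟨?_, fun U hU => ?_⟩
    · by_contra hV
      rw [not_nontrivial_iff_subsingleton] at hV
      exact bot_ne_top (α := Subrepresentation ρ)
        (Subrepresentation.toSubmodule_injective (Subsingleton.elim _ _))
    · rcases h.eq_bot_or_eq_top ⟨U, hU⟩ with h | h
      · exact Or.inl (congrArg Subrepresentation.toSubmodule h)
      · exact Or.inr (congrArg Subrepresentation.toSubmodule h)
  · rintro ⟨hV, h⟩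
    have : Nontrivial (Subrepresentation ρ) :=
      ⟨⊥, ⊤, fun h => bot_ne_top (α := Submodule ℂ V) (congrArg Subrepresentation.toSubmodule h)⟩
    refine ⟨fun W => ?_⟩
    rcases h W.toSubmodule fun g v hv => W.apply_mem_toSubmodule g hv with h | h
    · exact Or.inl (Subrepresentation.toSubmodule_injective h)
    · exact Or.inr (Subrepresentation.toSubmodule_injective h)

theorem rep_mul_apply (ρ : Representation ℂ G V) (g h : G) (v : V) :
    ρ (g * h) v = ρ g (ρ h v) := by
  rw [map_mul]; rfl

theorem exists_invariant_projection [Finite G] (ρ : Representation ℂ G V) (U : Submodule ℂ V)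
    (hU : ∀ g, ∀ v ∈ U, ρ g v ∈ U) :
    ∃ P : V →ₗ[ℂ] V, (∀ g v, P (ρ g v) = ρ g (P v)) ∧ (∀ v, P v ∈ U) ∧ ∀ v ∈ U, P v = v := by
  classical
  cases nonempty_fintype G
  obtain ⟨Q, hQ⟩ := U.subtype.exists_leftInverse_of_injective U.ker_subtype
  have hQ' : ∀ v (hv : v ∈ U), Q v = ⟨v, hv⟩ := fun v hv => LinearMap.congr_fun hQ ⟨v, hv⟩
  let P : V →ₗ[ℂ] V := (Fintype.card G : ℂ)⁻¹ • ∑ g : G, ρ g ∘ₗ U.subtype ∘ₗ Q ∘ₗ ρ g⁻¹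
  have hP : ∀ v, P v = (Fintype.card G : ℂ)⁻¹ • ∑ g : G, ρ g (Q (ρ g⁻¹ v) : V) := by
    intro v
    simp [P, LinearMap.sum_apply]
  refine ⟨P, fun g v => ?_, fun v => ?_, fun v hv => ?_⟩
  · rw [hP, hP, map_smul, map_sum]
    congr 1
    refine Fintype.sum_equiv (Equiv.mulLeft g⁻¹) _ _ fun x => ?_
    simp only [Equiv.coe_mulLeft, ← rep_mul_apply, _root_.mul_inv_rev, inv_inv, mul_inv_cancel_left]
  · rw [hP]
    exact U.smul_mem _ (U.sum_mem fun g _ => hU _ _ (Q _).2)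
  · rw [hP]
    have : ∀ g : G, ρ g (Q (ρ g⁻¹ v) : V) = v := fun g => by
      rw [hQ' _ (hU _ _ hv), ← rep_mul_apply]; simp
    simp only [this, Finset.sum_const, Finset.card_univ, ← Nat.cast_smul_eq_nsmul ℂ, smul_smul]
    rw [inv_mul_cancel₀ (by simp), one_smul]

theorem span_orbit_eq_top {ρ : Representation ℂ G V} (hρ : ρ.IsIrreducible) {v : V} (hv : v ≠ 0) :
    Submodule.span ℂ (Set.range fun g => ρ g v) = ⊤ := by
  refine ((isIrreducible_iff_forall_submodule.1 hρ).2 _ ?_).resolve_left fun h => hv ?_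
  · intro g w hw
    induction hw using Submodule.span_induction with
    | mem x hx =>
      obtain ⟨h, rfl⟩ := hx
      exact Submodule.subset_span ⟨g * h, rep_mul_apply ρ g h v⟩
    | zero => simp
    | add x y _ _ hx hy => rw [map_add]; exact add_mem hx hy
    | smul a x _ hx => rw [map_smul]; exact Submodule.smul_mem _ _ hx
  · have : v ∈ Submodule.span ℂ (Set.range fun g => ρ g v) :=
      Submodule.subset_span ⟨1, by simp⟩
    rwa [h, Submodule.mem_bot] at this

theorem finiteDimensional_of_isIrreducible [Finite G] {ρ : Representation ℂ G V}
    (hρ : ρ.IsIrreducible) : FiniteDimensional ℂ V := by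
  have := (isIrreducible_iff_forall_submodule.1 hρ).1
  obtain ⟨v, hv⟩ := exists_ne (0 : V)
  exact ⟨Submodule.fg_def.2 ⟨_, Set.finite_range _, span_orbit_eq_top hρ hv⟩⟩

theorem exists_eq_smul_of_commute [Finite G] {ρ : Representation ℂ G V} (hρ : ρ.IsIrreducible)
    (T : V →ₗ[ℂ] V) (hT : ∀ g v, ρ g (T v) = T (ρ g v)) : ∃ c : ℂ, ∀ v, T v = c • v := by
  have := finiteDimensional_of_isIrreducible hρ
  obtain ⟨hV, hU⟩ := isIrreducible_iff_forall_submodule.1 hρ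
  obtain ⟨c, hc⟩ := Module.End.exists_eigenvalue T
  refine ⟨c, fun v => ?_⟩
  have h := (hU (Module.End.eigenspace T c) fun g v hv => ?_).resolve_left hc
  · exact Module.End.mem_eigenspace_iff.1 (h ▸ Submodule.mem_top : v ∈ Module.End.eigenspace T c)
  · rw [Module.End.mem_eigenspace_iff] at hv ⊢
    rw [← hT, hv, map_smul]

/-- A constituent of the representation induced from a character `χ` contains `χ`. -/
theorem IsIrrOver.exists_eigenvector [Finite G] {H : Subgroup G} {χ : H →* ℂ}
    {ρ : Representation ℂ G V} (h : IsIrrOver (charRep χ) ρ) :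
    ∃ v : V, v ≠ 0 ∧ ∀ n : H, ρ n v = χ n • v := by
  obtain ⟨hρ, f, hf⟩ := h
  have hfg : ∀ g v, f (ρ g v) = Representation.ind H.subtype (charRep χ) g (f v) :=
    fun g v => Representation.IntertwiningMap.isIntertwining _ _ f g v
  obtain ⟨P, hPc, hPr, hPi⟩ := exists_invariant_projection
    (Representation.ind H.subtype (charRep χ)) (LinearMap.range f.toLinearMap) (by
      rintro g _ ⟨v, rfl⟩
      exact ⟨ρ g v, hfg g v⟩)
  -- `w 1` generates the induced representation and transforms under `H` by `χ`; its projection to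
  -- the copy of `ρ` is the required eigenvector.
  let w : ∀ _ : G, Representation.IndV H.subtype (charRep χ) :=
    fun h => Representation.IndV.mk H.subtype (charRep χ) h (1 : ℂ)
  have hw : ∀ g h, Representation.ind H.subtype (charRep χ) g (w h) = w (h * g⁻¹) :=
    fun g h => Representation.ind_mk _ _ _ _ _
  obtain ⟨v, hv⟩ := hPr (w 1)
  have hv : f v = P (w 1) := hv
  refine ⟨v, ?_, fun n => hf ?_⟩
  · rintro rfl
    have hP0 : P = 0 := by
      refine Representation.IndV.hom_ext _ _ fun g => LinearMap.ext_ring ?_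
      change P (w g) = 0
      have := hPc g⁻¹ (w 1)
      rwa [hw, ← hv, map_zero, map_zero, one_mul, inv_inv] at this
    have := (isIrreducible_iff_forall_submodule.1 hρ).1
    obtain ⟨u, hu⟩ := exists_ne (0 : V)
    have hfu : f u = 0 := by rw [← hPi (f u) ⟨u, rfl⟩, hP0]; rfl
    exact hu (hf (hfu.trans (map_zero f).symm))
  · have hn : w ((n : G)⁻¹) = χ n • w 1 := by
      have := Representation.Coinvariants.mk_self_apply
        (Representation.tprod ((Representation.leftRegular ℂ G).comp H.subtype) (charRep χ)) n
        (TensorProduct.tmul ℂ (MonoidAlgebra.single ((n : G)⁻¹) (1 : ℂ)) (1 : ℂ))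
      refine this.symm.trans ?_
      have h1 : χ n • w 1 = Representation.IndV.mk H.subtype (charRep χ) 1 (χ n) := by
        rw [← map_smul, smul_eq_mul, mul_one]
      rw [h1]
      simp [charRep]
      rfl
    rw [hfg, hv, ← hPc, hw, one_mul, hn, map_smul, map_smul, hv]

/-- `T` intertwines `ρ` twisted by the character `χ` with `ρ`. -/
def IsTwist (ρ : Representation ℂ G V) (χ : G →* ℂ) (T : V →ₗ[ℂ] V) : Prop :=
  ∀ g v, ρ g (T v) = χ g • T (ρ g v)

theorem IsTwist.comp {ρ : Representation ℂ G V} {χ χ' : G →* ℂ} {T T' : V →ₗ[ℂ] V}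
    (hT : IsTwist ρ χ T) (hT' : IsTwist ρ χ' T') : IsTwist ρ (χ * χ') (T ∘ₗ T') := by
  intro g v
  simp only [LinearMap.comp_apply, MonoidHom.mul_apply]
  rw [hT, hT', map_smul, smul_smul]

theorem char_ne_zero (χ : G →* ℂ) (g : G) : χ g ≠ 0 := by
  intro h
  have := map_mul χ g g⁻¹
  rw [h, zero_mul, mul_inv_cancel, map_one] at this
  exact one_ne_zero this

theorem IsTwist.injective {ρ : Representation ℂ G V} (hρ : ρ.IsIrreducible) {χ : G →* ℂ}
    {T : V →ₗ[ℂ] V} (hT : IsTwist ρ χ T) (h0 : T ≠ 0) : Function.Injective T := by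
  rw [← LinearMap.ker_eq_bot]
  refine ((isIrreducible_iff_forall_submodule.1 hρ).2 _ fun g v hv => ?_).resolve_right
    fun h => h0 (LinearMap.ker_eq_top.1 h)
  rw [LinearMap.mem_ker] at hv ⊢
  have := hT g v
  rw [hv, map_zero] at this
  exact (smul_eq_zero.1 this.symm).resolve_left (char_ne_zero χ g)

/-- An endomorphism commuting with the kernel of a homomorphism `δ` to a finite abelian group is
a combination of twists by characters that factor through `δ`. -/
theorem mem_span_isTwist [Finite G] {D : Type*} [CommGroup D] [Finite D] (δ : G →* D)
    (ρ : Representation ℂ G V) (T : V →ₗ[ℂ] V)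
    (hT : ∀ g, δ g = 1 → ∀ v, ρ g (T v) = T (ρ g v)) :
    T ∈ Submodule.span ℂ {T' | ∃ χ : D →* ℂ, IsTwist ρ (χ.comp δ) T'} := by
  classical
  cases nonempty_fintype G
  cases nonempty_fintype D
  -- Fourier components of `T` under conjugation by `G`. Conjugation by `ker δ` fixes `T`, so
  -- characters of `D` suffice to recover it.
  let X : AddChar (Additive D) ℂ → V →ₗ[ℂ] V := fun χ =>
    ∑ g : G, χ (Additive.ofMul (δ g⁻¹)) • (ρ g ∘ₗ T ∘ₗ ρ g⁻¹)
  have hX : ∀ χ, X χ ∈ Submodule.span ℂ {T' | ∃ χ : D →* ℂ, IsTwist ρ (χ.comp δ) T'} := by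
    intro χ
    refine Submodule.subset_span ⟨AddChar.toMonoidHom χ, fun h v => ?_⟩
    change ρ h (X χ v) = χ (Additive.ofMul (δ h)) • X χ (ρ h v)
    simp only [X, LinearMap.sum_apply, map_sum, Finset.smul_sum]
    refine Fintype.sum_equiv (Equiv.mulLeft h) _ _ fun g => ?_
    simp only [LinearMap.smul_apply, LinearMap.comp_apply, Equiv.coe_mulLeft, map_smul, smul_smul,
      ← rep_mul_apply, _root_.mul_inv_rev, inv_mul_cancel_right, map_mul δ, map_inv δ, ofMul_mul, ofMul_inv]
    rw [← AddChar.map_add_eq_mul]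
    congr 2
    abel
  have hsum : ∑ χ, X χ = ((Fintype.card D * Finset.card {g : G | δ g = 1} : ℕ) : ℂ) • T := by
    simp only [X]
    rw [Finset.sum_comm]
    simp only [← Finset.sum_smul]
    simp only [AddChar.sum_apply_eq_ite]
    have hi : ∀ g : G, (Additive.ofMul (δ g⁻¹) = 0) ↔ δ g = 1 := fun g => by
      rw [ofMul_eq_zero, map_inv, inv_eq_one]
    simp only [hi, ite_smul, zero_smul, ← Finset.sum_filter]
    have : ∀ g ∈ (Finset.univ.filter fun g : G => δ g = 1),
        ((Fintype.card (Additive D) : ℕ) : ℂ) • (ρ g ∘ₗ T ∘ₗ ρ g⁻¹) = (Fintype.card D : ℂ) • T := by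
      intro g hg
      rw [Fintype.card_additive]
      congr 1
      ext v
      simp only [LinearMap.comp_apply]
      rw [hT g (Finset.mem_filter.1 hg).2, ← rep_mul_apply]
      simp
    rw [Finset.sum_congr rfl this, Finset.sum_const, ← Nat.cast_smul_eq_nsmul ℂ, smul_smul]
    push_cast
    rw [mul_comm]
  have hne : ((Fintype.card D * Finset.card {g : G | δ g = 1} : ℕ) : ℂ) ≠ 0 := by
    rw [Nat.cast_ne_zero]
    refine mul_ne_zero Fintype.card_ne_zero (Finset.card_ne_zero_of_mem (a := 1) ?_)
    simp
  have hT' : T = ((Fintype.card D * Finset.card {g : G | δ g = 1} : ℕ) : ℂ)⁻¹ • ∑ χ, X χ := by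
    rw [hsum, smul_smul, inv_mul_cancel₀ hne, one_smul]
  rw [hT']
  exact Submodule.smul_mem _ _ (Submodule.sum_mem _ fun χ _ => hX χ)

/-- Restriction of an irreducible representation to the kernel of a homomorphism to a finite
abelian group: the case without nontrivial twists. -/
theorem isIrreducible_comp_of_forall_twist [Finite G] {D S : Type*} [CommGroup D] [Finite D]
    [Group S] (δ : G →* D) (ι : S →* G) (hι : ∀ g, δ g = 1 → ∃ s, ι s = g)
    {ρ : Representation ℂ G V} (hρ : ρ.IsIrreducible)
    (h : ∀ (χ : D →* ℂ) (T : V →ₗ[ℂ] V), IsTwist ρ (χ.comp δ) T → T ≠ 0 → χ = 1) :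
    Representation.IsIrreducible (ρ.comp ι) := by
  obtain ⟨hV, -⟩ := isIrreducible_iff_forall_submodule.1 hρ
  refine isIrreducible_iff_forall_submodule.2 ⟨hV, fun U hU => ?_⟩
  have hU' : ∀ g : δ.ker, ∀ v ∈ U, ρ.comp δ.ker.subtype g v ∈ U := by
    rintro ⟨g, hg⟩ v hv
    obtain ⟨s, rfl⟩ := hι g hg
    exact hU s v hv
  obtain ⟨P, hPc, hPr, hPi⟩ := exists_invariant_projection (ρ.comp δ.ker.subtype) U hU'
  have hP := mem_span_isTwist δ ρ P fun g hg v => (hPc ⟨g, hg⟩ v).symm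
  have hscal : ∃ c : ℂ, ∀ v, P v = c • v := by
    refine exists_eq_smul_of_commute hρ P fun g v => ?_
    clear hPc hPr hPi
    induction hP using Submodule.span_induction generalizing v with
    | mem T hT =>
      obtain ⟨χ, hχ⟩ := hT
      by_cases h0 : T = 0
      · simp [h0]
      · have := hχ g v
        rwa [h χ T hχ h0, MonoidHom.comp_apply, MonoidHom.one_apply, one_smul] at this
    | zero => simp
    | add x y _ _ hx hy => simp [hx, hy]
    | smul a x _ hx => simp [hx]
  obtain ⟨c, hc⟩ := hscal
  by_cases h0 : c = 0
  · left
    rw [eq_bot_iff]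
    intro v hv
    rw [Submodule.mem_bot, ← hPi v hv, hc, h0, zero_smul]
  · right
    rw [eq_top_iff]
    intro v _
    have := U.smul_mem c⁻¹ (hPr v)
    rwa [hc, smul_smul, inv_mul_cancel₀ h0, one_smul] at this

/-- Restriction of an irreducible representation to the kernel of a homomorphism to a finite
abelian group: the case of at most one nontrivial twist. -/
theorem isIrreducible_or_sum_comp_of_forall_twist [Finite G] {D S : Type*} [CommGroup D] [Finite D]
    [Group S] (δ : G →* D) (ι : S →* G) (hδ : Function.Surjective δ)
    (hι : ∀ g, δ g = 1 ↔ ∃ s, ι s = g)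
    {ρ : Representation ℂ G V} (hρ : ρ.IsIrreducible)
    (hsq : ∀ (χ : D →* ℂ) (T : V →ₗ[ℂ] V), IsTwist ρ (χ.comp δ) T → T ≠ 0 → χ * χ = 1)
    (huniq : ∀ (χ χ' : D →* ℂ) (T T' : V →ₗ[ℂ] V), IsTwist ρ (χ.comp δ) T → T ≠ 0 →
      IsTwist ρ (χ'.comp δ) T' → T' ≠ 0 → χ ≠ 1 → χ' ≠ 1 → χ = χ') :
    Representation.IsIrreducible (ρ.comp ι) ∨ IsSumOfTwoIrreduciblesOfHalfDim (ρ.comp ι) := by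
  by_cases htriv : ∀ (χ : D →* ℂ) (T : V →ₗ[ℂ] V), IsTwist ρ (χ.comp δ) T → T ≠ 0 → χ = 1
  · exact Or.inl (isIrreducible_comp_of_forall_twist δ ι (fun g => (hι g).1) hρ htriv)
  right
  push Not at htriv
  obtain ⟨χ, T, hT, hT0, hχ⟩ := htriv
  have := finiteDimensional_of_isIrreducible hρ
  obtain ⟨hV, -⟩ := isIrreducible_iff_forall_submodule.1 hρ
  have hTinj := hT.injective hρ hT0
  have hχsq := hsq χ T hT hT0
  have hscal : ∀ {T' : V →ₗ[ℂ] V}, IsTwist ρ 1 T' → ∃ c : ℂ, ∀ v, T' v = c • v := by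
    intro T' hT'
    exact exists_eq_smul_of_commute hρ T' fun g v => by simpa using hT' g v
  -- The composite is a twist by `χ * χ = 1`, so Schur's lemma applies.
  have hTT : ∀ {T' : V →ₗ[ℂ] V}, IsTwist ρ (χ.comp δ) T' → ∃ c : ℂ, ∀ v, T (T' v) = c • v := by
    intro T' hT'
    refine hscal (T' := T ∘ₗ T') ?_
    have := hT.comp hT'
    rwa [← MonoidHom.mul_comp, hχsq, MonoidHom.one_comp] at this
  obtain ⟨c, hc⟩ := hTT hT
  have hc0 : c ≠ 0 := by
    rintro rfl
    obtain ⟨v, hv⟩ := exists_ne (0 : V)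
    refine hv (hTinj (hTinj ?_))
    rw [hc, zero_smul, map_zero, map_zero]
  -- As `T² = s²`, the summands will be the eigenspaces of `T` for `s` and `-s`.
  obtain ⟨s, hs⟩ := IsAlgClosed.exists_pow_nat_eq c (n := 2) (by norm_num)
  have hs0 : s ≠ 0 := by rintro rfl; exact hc0 (by rw [← hs]; norm_num)
  -- The commutant of the restriction is spanned by the identity and `T`.
  have hcomb : ∀ P : V →ₗ[ℂ] V, (∀ g, δ g = 1 → ∀ v, ρ g (P v) = P (ρ g v)) →
      ∃ a b : ℂ, ∀ v, P v = a • v + b • T v := by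
    intro P hPc
    have hP := mem_span_isTwist δ ρ P hPc
    clear hPc
    induction hP using Submodule.span_induction with
    | mem T' hT' =>
      obtain ⟨χ', hχ'⟩ := hT'
      by_cases h0 : T' = 0
      · exact ⟨0, 0, by simp [h0]⟩
      by_cases h1 : χ' = 1
      · subst h1
        obtain ⟨a, ha⟩ := hscal (T' := T') (by simpa using hχ')
        exact ⟨a, 0, by simp [ha]⟩
      · have := huniq χ χ' T T' hT hT0 hχ' h0 hχ h1
        subst this
        obtain ⟨a, ha⟩ := hTT hχ'
        refine ⟨0, a * c⁻¹, fun v => hTinj ?_⟩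
        rw [ha, zero_smul, zero_add, map_smul, hc, smul_smul, mul_assoc, inv_mul_cancel₀ hc0,
          mul_one]
    | zero => exact ⟨0, 0, by simp⟩
    | add x y _ _ hx hy =>
      obtain ⟨a, b, h⟩ := hx
      obtain ⟨a', b', h'⟩ := hy
      refine ⟨a + a', b + b', fun v => ?_⟩
      rw [LinearMap.add_apply, h, h', add_smul, add_smul]
      abel
    | smul k x _ hx =>
      obtain ⟨a, b, h⟩ := hx
      exact ⟨k * a, k * b, fun v => by rw [LinearMap.smul_apply, h, smul_add, smul_smul, smul_smul]⟩
  have hιT : ∀ t v, ρ (ι t) (T v) = T (ρ (ι t) v) := by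
    intro t v
    have := hT (ι t) v
    rwa [MonoidHom.comp_apply, (hι (ι t)).2 ⟨t, rfl⟩, map_one, one_smul] at this
  let W : ℂ → Submodule ℂ V := fun x => Module.End.eigenspace T x
  have hW : ∀ x v, v ∈ W x ↔ T v = x • v := fun x v => Module.End.mem_eigenspace_iff
  let Wr : ℂ → Subrepresentation (ρ.comp ι) := fun x => ⟨W x, fun t v hv => by
    rw [hW] at hv ⊢
    change T (ρ (ι t) v) = x • ρ (ι t) v
    rw [← hιT, hv, map_smul]⟩
  -- Such a `g` has `χ (δ g) = -1` and swaps the two eigenspaces, hence the equal dimensions.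
  obtain ⟨g, hg⟩ : ∃ g, χ (δ g) ≠ 1 := by
    by_contra! hall
    refine hχ (MonoidHom.ext fun d => ?_)
    obtain ⟨g, rfl⟩ := hδ d
    exact hall g
  have hg : χ (δ g) = -1 := by
    have := DFunLike.congr_fun hχsq (δ g)
    rw [MonoidHom.mul_apply, MonoidHom.one_apply] at this
    exact (mul_self_eq_one_iff.1 this).resolve_left hg
  have hswap : ∀ x, ∀ v ∈ W x, ρ g v ∈ W (-x) := by
    intro x v hv
    rw [hW] at hv ⊢
    have := hT g v
    rw [MonoidHom.comp_apply, hg, hv, map_smul, neg_one_smul] at this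
    rw [neg_smul, this, neg_neg]
  have hle : ∀ x, Module.finrank ℂ (W x) ≤ Module.finrank ℂ (W (-x)) := by
    intro x
    refine LinearMap.finrank_le_finrank_of_injective
      (f := (ρ g).restrict (hswap x)) ?_
    intro u v huv
    have : ρ g u = ρ g v := congrArg Subtype.val huv
    have := congrArg (ρ g⁻¹) this
    simpa [← rep_mul_apply] using this
  have hcompl : IsCompl (W s) (W (-s)) := by
    constructor
    · rw [Submodule.disjoint_def]
      intro v h1 h2
      rw [hW] at h1 h2
      have h3 : (2 * s) • v = 0 := by
        rw [h1, neg_smul, ← sub_eq_zero, sub_neg_eq_add, ← two_smul ℂ, smul_smul] at h2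
        exact h2
      exact (smul_eq_zero.1 h3).resolve_left (by simpa using hs0)
    · rw [codisjoint_iff, eq_top_iff]
      intro v _
      have hv : v = (2 * s)⁻¹ • (s • v + T v) + (2 * s)⁻¹ • (s • v - T v) := by
        rw [← smul_add, add_add_sub_cancel, ← two_smul ℂ (s • v), smul_smul, smul_smul,
          mul_assoc, inv_mul_cancel₀ (by simpa using hs0), one_smul]
      have hTT : T (T v) = (s * s) • v := by rw [hc, ← hs, sq]
      rw [hv]
      refine Submodule.add_mem_sup (Submodule.smul_mem _ _ ?_) (Submodule.smul_mem _ _ ?_)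
      · rw [hW, map_add, map_smul, hTT, smul_add, smul_smul, add_comm]
      · rw [hW, map_sub, map_smul, hTT, smul_sub, smul_smul, neg_mul, neg_smul, neg_smul]
        abel
  have hdim : ∀ x, Module.finrank ℂ (W x) = Module.finrank ℂ (W (-x)) := fun x =>
    le_antisymm (hle x) ((hle (-x)).trans_eq (by rw [neg_neg]))
  have hsum : Module.finrank ℂ (W s) + Module.finrank ℂ (W (-s)) = Module.finrank ℂ V :=
    Submodule.finrank_add_eq_of_isCompl hcompl
  have hds := hdim s
  have hne : ∀ x, x = s ∨ x = -s → Nontrivial (W x) := by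
    have hpos : 0 < Module.finrank ℂ V := Module.finrank_pos
    rintro x (rfl | rfl) <;> refine Module.nontrivial_of_finrank_pos (R := ℂ) ?_ <;> omega
  have hirr : ∀ x, x = s ∨ x = -s → (Wr x).toRepresentation.IsIrreducible := by
    intro x hx
    refine isIrreducible_iff_forall_submodule.2 ⟨hne x hx, fun U hU => ?_⟩
    have hU' : ∀ k : δ.ker, ∀ v ∈ U.map (W x).subtype, ρ.comp δ.ker.subtype k v ∈
        U.map (W x).subtype := by
      rintro ⟨k, hk⟩ _ ⟨v, hv, rfl⟩
      obtain ⟨t, rfl⟩ := (hι k).1 hk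
      exact ⟨_, hU t v hv, rfl⟩
    obtain ⟨P, hPc, hPr, hPi⟩ := exists_invariant_projection (ρ.comp δ.ker.subtype) _ hU'
    obtain ⟨a, b, hab⟩ := hcomb P fun k hk v => (hPc ⟨k, hk⟩ v).symm
    by_cases hbot : U = ⊥
    · exact Or.inl hbot
    right
    obtain ⟨u, hu, hu0⟩ := U.ne_bot_iff.1 hbot
    -- On an eigenspace of `T` every `a + b T` is a scalar, so a nonzero invariant subspace is
    -- everything.
    have hPW : ∀ v : W x, P v = (a + b * x) • (v : V) := fun v => by
      rw [hab, (hW x v).1 v.2, smul_smul, add_smul]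
    have h1 : (a + b * x) = 1 := by
      have h2 := hPi u ⟨u, hu, rfl⟩
      change P ((u : W x) : V) = (u : V) at h2
      rw [hPW] at h2
      have h3 : (a + b * x - 1) • (u : V) = 0 := by rw [sub_smul, one_smul, h2, sub_self]
      exact sub_eq_zero.1 ((smul_eq_zero.1 h3).resolve_right (by simpa using hu0))
    rw [eq_top_iff]
    intro v _
    obtain ⟨v', hv', h2⟩ := hPr v
    rw [hPW, h1, one_smul] at h2
    rwa [← Subtype.ext h2]
  refine ⟨Wr s, Wr (-s), hcompl, hirr s (Or.inl rfl), hirr (-s) (Or.inr rfl), ?_, ?_⟩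
  · change 2 * Module.finrank ℂ (W s) = _
    omega
  · change 2 * Module.finrank ℂ (W (-s)) = _
    omega

end RepresentationTheory

/-! ### Clifford theory for characters of a normal subgroup -/

section CliffordTheory

variable {G : Type*} [Group G] {V : Type*} [AddCommGroup V] [Module ℂ V]
  {ρ : Representation ℂ G V} {N : Subgroup G}

/-- The vectors on which a subgroup `N` acts through the character `θ`. -/
def charEigenspace (ρ : Representation ℂ G V) (θ : N →* ℂ) : Submodule ℂ V where
  carrier := {v | ∀ n : N, ρ n v = θ n • v}
  add_mem' := by
    intro a b ha hb n
    rw [map_add, ha, hb, smul_add]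
  zero_mem' := by simp
  smul_mem' := by
    intro c v hv n
    rw [map_smul, hv, smul_comm]

theorem IsTwist.apply_mem_charEigenspace {χ : G →* ℂ} {T : V →ₗ[ℂ] V} (hT : IsTwist ρ χ T)
    {θ : N →* ℂ} {v : V} (hv : v ∈ charEigenspace ρ θ) :
    T v ∈ charEigenspace ρ (χ.comp N.subtype * θ) := by
  intro n
  rw [hT, hv n, map_smul, smul_smul]
  rfl

theorem apply_mem_charEigenspace_conj [N.Normal] {θ : N →* ℂ} {v : V}
    (hv : v ∈ charEigenspace ρ θ) (g : G) :
    ρ g v ∈ charEigenspace ρ (θ.comp (MulAut.conjNormal g⁻¹ : MulAut N).toMonoidHom) := by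
  intro n
  have := hv (MulAut.conjNormal g⁻¹ n)
  rw [MulAut.conjNormal_apply, inv_inv] at this
  change _ = θ (MulAut.conjNormal g⁻¹ n) • ρ g v
  rw [← map_smul, ← this, ← rep_mul_apply, ← rep_mul_apply]
  congr 2
  group

variable [Finite G]

/-- The unnormalized projector to `charEigenspace ρ θ`. -/
noncomputable def charProjector (ρ : Representation ℂ G V) (θ : N →* ℂ) : V →ₗ[ℂ] V :=
  letI := Fintype.ofFinite N
  ∑ n : N, θ n⁻¹ • ρ n

theorem charProjector_apply_of_mem {θ : N →* ℂ} {v : V} (hv : v ∈ charEigenspace ρ θ) :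
    charProjector ρ θ v = (Nat.card N : ℂ) • v := by
  let := Fintype.ofFinite N
  simp only [charProjector, LinearMap.sum_apply, LinearMap.smul_apply]
  have : ∀ n : N, θ n⁻¹ • ρ n v = v := fun n => by
    rw [hv n, smul_smul, ← map_mul, inv_mul_cancel, map_one, one_smul]
  simp only [this, Finset.sum_const, Finset.card_univ, Nat.card_eq_fintype_card,
    ← Nat.cast_smul_eq_nsmul ℂ]

theorem charProjector_apply_of_ne {θ θ' : N →* ℂ} (h : θ ≠ θ') {v : V}
    (hv : v ∈ charEigenspace ρ θ') : charProjector ρ θ v = 0 := by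
  let := Fintype.ofFinite N
  simp only [charProjector, LinearMap.sum_apply, LinearMap.smul_apply]
  let f : N →* ℂ :=
    { toFun := fun n => θ n⁻¹ * θ' n
      map_one' := by simp
      map_mul' := fun a b => by rw [_root_.mul_inv_rev, map_mul, map_mul]; ring }
  have hf : f ≠ 1 := by
    intro hf
    refine h (MonoidHom.ext fun n => ?_)
    have h1 : θ n⁻¹ * θ' n = 1 := DFunLike.congr_fun hf n
    have h2 : θ n * θ n⁻¹ = 1 := by rw [← map_mul, mul_inv_cancel, map_one]
    calc θ n = θ n * (θ n⁻¹ * θ' n) := by rw [h1, mul_one]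
      _ = θ' n := by rw [← mul_assoc, h2, one_mul]
  have h1 : ∀ n : N, θ n⁻¹ • ρ n v = f n • v := fun n => by rw [hv n, smul_smul]; rfl
  simp only [h1, ← Finset.sum_smul, sum_hom_units_eq_zero f hf, zero_smul]

variable [N.Normal]

/-- The characters of a normal subgroup occurring in an irreducible representation are
conjugate. -/
theorem exists_conj_eq_of_mem_charEigenspace (hρ : ρ.IsIrreducible) {θ θ' : N →* ℂ} {v v' : V}
    (hv : v ∈ charEigenspace ρ θ) (hv0 : v ≠ 0) (hv' : v' ∈ charEigenspace ρ θ') (hv0' : v' ≠ 0) :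
    ∃ g : G, θ' = θ.comp (MulAut.conjNormal g⁻¹ : MulAut N).toMonoidHom := by
  by_contra! h
  have h0 : charProjector ρ θ' = 0 := by
    refine LinearMap.ext_on (span_orbit_eq_top hρ hv0) ?_
    rintro _ ⟨g, rfl⟩
    exact charProjector_apply_of_ne (h g) (apply_mem_charEigenspace_conj hv g)
  have := charProjector_apply_of_mem hv'
  rw [h0, LinearMap.zero_apply, eq_comm, smul_eq_zero] at this
  exact this.elim (Nat.cast_ne_zero.2 Nat.card_pos.ne') hv0'

/-- An element that commutes with the stabilizer of `θ` modulo the kernel of `θ` acts as a scalar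
on the `θ`-eigenspace. -/
theorem exists_apply_eq_smul_of_commute_stabilizer (hρ : ρ.IsIrreducible) {θ : N →* ℂ} {c : G}
    (hcθ : θ.comp (MulAut.conjNormal c⁻¹ : MulAut N).toMonoidHom = θ)
    (hc : ∀ g : G, θ.comp (MulAut.conjNormal g⁻¹ : MulAut N).toMonoidHom = θ →
      ∃ n : N, c * g = g * c * n ∧ θ n = 1) :
    ∃ a : ℂ, ∀ v ∈ charEigenspace ρ θ, ρ c v = a • v := by
  have := finiteDimensional_of_isIrreducible hρ
  rcases subsingleton_or_nontrivial (charEigenspace ρ θ) with hU | hU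
  · refine ⟨0, fun v hv => ?_⟩
    have : v = 0 := congrArg Subtype.val
      (Subsingleton.elim (⟨v, hv⟩ : charEigenspace ρ θ) 0)
    rw [this, map_zero, smul_zero]
  have hmaps : ∀ v ∈ charEigenspace ρ θ, ρ c v ∈ charEigenspace ρ θ := fun v hv => by
    have := apply_mem_charEigenspace_conj hv c
    rwa [hcθ] at this
  obtain ⟨a, ha⟩ := Module.End.exists_eigenvalue ((ρ c).restrict hmaps)
  obtain ⟨u, hu, hu0⟩ := ha.exists_hasEigenvector
  rw [Module.End.mem_eigenspace_iff] at hu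
  have hu : ρ c u = a • (u : V) := congrArg Subtype.val hu
  have hu0 : (u : V) ≠ 0 := by simpa using hu0
  -- The projector kills `ρ g u` when `g` moves `θ`. Otherwise it rescales `ρ g u`, which lies in
  -- the `a`-eigenspace of `ρ c` because `c` and `g` commute modulo the kernel of `θ`.
  have hE : ∀ v, charProjector ρ θ v ∈ Module.End.eigenspace (ρ c) a := by
    intro v
    have hv : v ∈ Submodule.span ℂ (Set.range fun g => ρ g (u : V)) := by
      rw [span_orbit_eq_top hρ hu0]; trivial
    induction hv using Submodule.span_induction with
    | mem x hx =>
      obtain ⟨g, rfl⟩ := hx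
      by_cases hg : θ = θ.comp (MulAut.conjNormal g⁻¹ : MulAut N).toMonoidHom
      · have h1 := apply_mem_charEigenspace_conj u.2 g
        rw [← hg] at h1
        rw [charProjector_apply_of_mem h1]
        refine Submodule.smul_mem _ _ (Module.End.mem_eigenspace_iff.2 ?_)
        obtain ⟨n, hn, hn1⟩ := hc g hg.symm
        rw [← rep_mul_apply, hn, rep_mul_apply, u.2 n, hn1, one_smul, rep_mul_apply, hu, map_smul]
      · rw [charProjector_apply_of_ne hg (apply_mem_charEigenspace_conj u.2 g)]
        exact zero_mem _
    | zero => rw [map_zero]; exact zero_mem _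
    | add x y _ _ hx hy => rw [map_add]; exact add_mem hx hy
    | smul k x _ hx => rw [map_smul]; exact Submodule.smul_mem _ _ hx
  refine ⟨a, fun v hv => ?_⟩
  have h1 := hE v
  rw [charProjector_apply_of_mem hv, Submodule.smul_mem_iff _ (Nat.cast_ne_zero.2 Nat.card_pos.ne')] at h1
  exact Module.End.mem_eigenspace_iff.1 h1

/-- As `χ` is trivial on `N`, `T` preserves the `θ`-eigenspace, where `c` acts by a single nonzero
scalar. Comparing its action on `v` and on `T v` leaves no room for `χ c`. -/
theorem IsTwist.apply_eq_one (hρ : ρ.IsIrreducible) {χ : G →* ℂ} {T : V →ₗ[ℂ] V}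
    (hT : IsTwist ρ χ T) (hT0 : T ≠ 0) {θ : N →* ℂ} {v : V} (hv : v ∈ charEigenspace ρ θ)
    (hv0 : v ≠ 0) (hN : ∀ n : N, χ n = 1) {c : G}
    (hcθ : θ.comp (MulAut.conjNormal c⁻¹ : MulAut N).toMonoidHom = θ)
    (hc : ∀ g : G, θ.comp (MulAut.conjNormal g⁻¹ : MulAut N).toMonoidHom = θ →
      ∃ n : N, c * g = g * c * n ∧ θ n = 1) : χ c = 1 := by
  obtain ⟨a, ha⟩ := exists_apply_eq_smul_of_commute_stabilizer (ρ := ρ) hρ hcθ hc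
  have hTv : T v ∈ charEigenspace ρ θ := by
    have h1 : χ.comp N.subtype = 1 := MonoidHom.ext hN
    have := hT.apply_mem_charEigenspace hv
    rwa [h1, one_mul] at this
  have hTv0 : T v ≠ 0 := fun h => hv0 (hT.injective hρ hT0 (h.trans (map_zero T).symm))
  have ha0 : a ≠ 0 := by
    rintro rfl
    have h1 := ha v hv
    have h2 := congrArg (ρ c⁻¹) h1
    rw [← rep_mul_apply, zero_smul, map_zero, inv_mul_cancel, map_one] at h2
    exact hv0 h2
  have h1 := hT c v
  rw [ha _ hTv, ha v hv, map_smul, smul_smul] at h1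
  have h2 : (a - χ c * a) • T v = 0 := by rw [sub_smul, ← h1, sub_self]
  have h3 := (smul_eq_zero.1 h2).resolve_right hTv0
  have h4 : (1 - χ c) * a = 0 := by rw [← h3]; ring
  exact (sub_eq_zero.1 ((mul_eq_zero.1 h4).resolve_right ha0)).symm

end CliffordTheory

/-! ### Arithmetic in the finite quotients of the valuation ring -/

section ChainRing

/-- `R` is a local ring whose maximal ideal is generated by `p`, with `p ^ r = 0`, and every element
of `R` is a square modulo `p`. -/
structure IsSquareClosedChainRing (R : Type*) [CommRing R] (p : R) (r : ℕ) : Prop where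
  isUnit_or_dvd : ∀ x : R, IsUnit x ∨ p ∣ x
  pow_eq_zero : p ^ r = 0
  exists_dvd_sub_sq : ∀ x : R, ∃ z, p ∣ x - z ^ 2

namespace IsSquareClosedChainRing

variable {R : Type*} [CommRing R] {p : R} {r : ℕ}

theorem pow_eq_zero_of_le (hR : IsSquareClosedChainRing R p r) {n : ℕ} (hn : r ≤ n) : p ^ n = 0 :=
  _root_.pow_eq_zero_of_le hn hR.pow_eq_zero

theorem not_dvd_of_isUnit [Nontrivial R] (hR : IsSquareClosedChainRing R p r) {x : R}
    (hx : IsUnit x) : ¬ p ∣ x := by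
  intro h
  have := (isUnit_of_dvd_unit h hx).pow r
  rw [hR.pow_eq_zero] at this
  exact not_isUnit_zero this

theorem isUnit_add_mul [Nontrivial R] (hR : IsSquareClosedChainRing R p r) {x : R}
    (hx : IsUnit x) (y : R) : IsUnit (x + p * y) := by
  refine (hR.isUnit_or_dvd _).resolve_right fun h => hR.not_dvd_of_isUnit hx ?_
  exact (dvd_add_left (dvd_mul_right p y)).1 h

theorem pow_dvd_or_exists (hR : IsSquareClosedChainRing R p r) (n : ℕ) (x : R) :
    p ^ n ∣ x ∨ ∃ k < n, ∃ u, IsUnit u ∧ x = p ^ k * u := by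
  induction n with
  | zero => simp
  | succ n ih =>
    rcases ih with ⟨y, rfl⟩ | ⟨k, hk, u, hu, rfl⟩
    · rcases hR.isUnit_or_dvd y with hy | ⟨z, rfl⟩
      · exact Or.inr ⟨n, n.lt_succ_self, y, hy, rfl⟩
      · exact Or.inl ⟨z, by ring⟩
    · exact Or.inr ⟨k, hk.trans n.lt_succ_self, u, hu, rfl⟩

theorem pow_pred_ne_zero {ψ : AddChar R ℂ} (hψ : ψ (p ^ (r - 1)) ≠ 1) : p ^ (r - 1) ≠ 0 := by
  intro h
  rw [h, AddChar.map_zero_eq_one] at hψ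
  exact hψ rfl

/-- A nonzero `a` is a unit times `p ^ k` with `k < r`, so it has `p ^ (r - 1)` as a multiple. This
is the nondegeneracy of the pairing `ψ (a * x)`. -/
theorem eq_zero_of_forall_char (hR : IsSquareClosedChainRing R p r) {ψ : AddChar R ℂ}
    (hψ : ψ (p ^ (r - 1)) ≠ 1) {a : R} (ha : ∀ x, ψ (a * x) = 1) : a = 0 := by
  rcases hR.pow_dvd_or_exists r a with h | ⟨k, hk, u, hu, rfl⟩
  · rwa [hR.pow_eq_zero, zero_dvd_iff] at h
  · obtain ⟨v, hv⟩ := hu.exists_right_inv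
    refine absurd (ha (v * p ^ (r - 1 - k))) ?_
    have : p ^ k * u * (v * p ^ (r - 1 - k)) = p ^ (r - 1) := by
      rw [mul_assoc, ← mul_assoc u, hv, one_mul, ← pow_add]
      congr 1
      omega
    rwa [this]

theorem pow_dvd_of_pow_mul_eq_zero (hR : IsSquareClosedChainRing R p r) (hp : p ^ (r - 1) ≠ 0)
    {i j : ℕ} (hij : i + j ≤ r) {x : R} (hx : p ^ i * x = 0) : p ^ j ∣ x := by
  refine (hR.pow_dvd_or_exists j x).resolve_right ?_
  rintro ⟨k, hk, u, hu, rfl⟩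
  rw [← mul_assoc, ← pow_add, hu.mul_left_eq_zero] at hx
  exact hp (_root_.pow_eq_zero_of_le (by omega) hx)

/-- Multiplication by `p ^ (r - 1)` sees only residues modulo `p`, where the inverse of `t` is a
square. -/
theorem exists_pow_pred_mul (hR : IsSquareClosedChainRing R p r) (hr : 1 ≤ r) {t : R}
    (ht : IsUnit t) : ∃ z, p ^ (r - 1) * (t * z ^ 2) = p ^ (r - 1) := by
  obtain ⟨v, hv⟩ := ht.exists_right_inv
  obtain ⟨z, w, hz⟩ := hR.exists_dvd_sub_sq v
  refine ⟨z, ?_⟩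
  have h : p ^ (r - 1) * p = 0 := by
    rw [← pow_succ]
    exact hR.pow_eq_zero_of_le (by omega)
  linear_combination (-t) * p ^ (r - 1) * hz + p ^ (r - 1) * hv - t * w * h

theorem exists_eq_sq_mul [Nontrivial R] (hR : IsSquareClosedChainRing R p r) (u : Rˣ) :
    ∃ (s v : Rˣ) (w : R), u = s * s * v ∧ (v : R) = 1 + p * w := by
  obtain ⟨z, w, hz⟩ := hR.exists_dvd_sub_sq (u : R)
  have hzu : IsUnit z := by
    refine (hR.isUnit_or_dvd z).resolve_right fun h => hR.not_dvd_of_isUnit u.isUnit ?_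
    rw [sub_eq_iff_eq_add.1 hz]
    exact dvd_add (dvd_mul_right _ _) (dvd_pow h two_ne_zero)
  obtain ⟨s, rfl⟩ := hzu
  refine ⟨s, (s * s)⁻¹ * u, ((s * s)⁻¹ : Rˣ) * w, by rw [mul_inv_cancel_left], ?_⟩
  rw [Units.val_mul, sub_eq_iff_eq_add.1 hz, mul_add, sq, ← Units.val_mul s s, Units.inv_mul]
  ring

/-- The map in `y` is injective on a finite ring: a difference of values is `y - y'` times a unit.
It serves to solve `det (1 + p y A) = 1 + p w`. -/
theorem exists_mul_add_eq [Nontrivial R] [Finite R] (hR : IsSquareClosedChainRing R p r) {t : R}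
    (ht : IsUnit t) (d w : R) : ∃ y, y * t + p * y ^ 2 * d = w := by
  refine Finite.surjective_of_injective (f := fun y : R => y * t + p * y ^ 2 * d) ?_ w
  intro y y' h
  have h1 : (y - y') * (t + p * (d * (y + y'))) = 0 := by
    simp only at h
    linear_combination h
  exact sub_eq_zero.1 ((hR.isUnit_add_mul ht _).mul_left_eq_zero.1 h1)

end IsSquareClosedChainRing

end ChainRing

/-! ### Congruence subgroups and their characters -/

section CongruenceSubgroup

variable {R : Type*} [CommRing R]

instance congruenceSubgroup_normal (x : R) : (congruenceSubgroup x).Normal where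
  conj_mem := by
    rintro n ⟨B, hB⟩ g
    refine ⟨(g : Matrix (Fin 2) (Fin 2) R) * B * ((g⁻¹ : GL (Fin 2) R) : Matrix _ _ R), ?_⟩
    rw [Units.val_mul, Units.val_mul, hB, mul_add, mul_one, add_mul, Units.mul_inv,
      mul_smul_comm, smul_mul_assoc]

theorem det_one_add_smul_fin_two (x : R) (B : Matrix (Fin 2) (Fin 2) R) :
    (1 + x • B).det = 1 + x * B.trace + x * x * B.det := by
  simp only [det_fin_two, trace_fin_two, Matrix.add_apply, Matrix.smul_apply, smul_eq_mul, one_apply]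
  norm_num
  ring

theorem exists_mem_congruenceSubgroup {x : R} (hx : x * x = 0) (B : Matrix (Fin 2) (Fin 2) R) :
    ∃ n : congruenceSubgroup x,
      ((n : GL (Fin 2) R) : Matrix (Fin 2) (Fin 2) R) = 1 + x • B ∧
      ((GeneralLinearGroup.det (n : GL (Fin 2) R) : Rˣ) : R) = 1 + x * B.trace := by
  have h0 : (x • B) * (x • B) = 0 := by
    rw [smul_mul_assoc, mul_smul_comm, smul_smul, hx, zero_smul]
  have h1 : (1 + x • B) * (1 - x • B) = 1 := by
    simp only [add_mul, mul_sub, one_mul, mul_one, h0]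
    abel
  have h2 : (1 - x • B) * (1 + x • B) = 1 := by
    simp only [sub_mul, mul_add, one_mul, mul_one, h0]
    abel
  refine ⟨⟨⟨1 + x • B, 1 - x • B, h1, h2⟩, B, rfl⟩, rfl, ?_⟩
  rw [GeneralLinearGroup.val_det_apply]
  exact (det_one_add_smul_fin_two x B).trans (by rw [hx, zero_mul, add_zero])

theorem conj_congruenceSubgroup_sub_one {x : R} (g : GL (Fin 2) R) (n : congruenceSubgroup x) :
    (((MulAut.conjNormal g⁻¹ n : congruenceSubgroup x) : GL (Fin 2) R) :
      Matrix (Fin 2) (Fin 2) R) - 1 =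
      ((g⁻¹ : GL (Fin 2) R) : Matrix (Fin 2) (Fin 2) R) *
        (((n : GL (Fin 2) R) : Matrix (Fin 2) (Fin 2) R) - 1) * (g : Matrix (Fin 2) (Fin 2) R) := by
  rw [MulAut.conjNormal_apply, inv_inv, Units.val_mul, Units.val_mul, mul_sub, sub_mul, mul_one,
    Units.inv_mul]

theorem trace_mul_conj (A B : Matrix (Fin 2) (Fin 2) R) (g : GL (Fin 2) R) :
    (A * (((g⁻¹ : GL (Fin 2) R) : Matrix (Fin 2) (Fin 2) R) * B * (g : Matrix _ _ R))).trace =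
      ((g : Matrix _ _ R) * A * ((g⁻¹ : GL (Fin 2) R) : Matrix (Fin 2) (Fin 2) R) * B).trace := by
  rw [← mul_assoc, trace_mul_comm, ← mul_assoc, ← mul_assoc]

end CongruenceSubgroup

section CharactersOfCongruenceSubgroups

variable {R : Type*} [CommRing R] {p : R} {r : ℕ}

/-- Testing against trace-zero matrices cannot detect scalars, so the conclusion is exactly that `q
• C` is scalar. -/
theorem smul_entries_of_forall_char (hR : IsSquareClosedChainRing R p r) {ψ : AddChar R ℂ}
    (hψ : ψ (p ^ (r - 1)) ≠ 1) {q : R} {C : Matrix (Fin 2) (Fin 2) R}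
    (h : ∀ B : Matrix (Fin 2) (Fin 2) R, B.trace = 0 → ψ (q * (C * B).trace) = 1) :
    q * C 0 1 = 0 ∧ q * C 1 0 = 0 ∧ q * C 0 0 = q * C 1 1 := by
  refine ⟨hR.eq_zero_of_forall_char hψ fun x => ?_, hR.eq_zero_of_forall_char hψ fun x => ?_,
    sub_eq_zero.1 (hR.eq_zero_of_forall_char hψ fun x => ?_)⟩
  · rw [← h !![0, 0; x, 0] (by simp [trace_fin_two])]
    congr 1
    simp [trace_fin_two, mul_apply]
    ring
  · rw [← h !![0, x; 0, 0] (by simp [trace_fin_two])]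
    congr 1
    simp [trace_fin_two, mul_apply]
    ring
  · rw [← h !![x, 0; 0, -x] (by simp [trace_fin_two])]
    congr 1
    simp [trace_fin_two, mul_apply]
    ring

theorem conj_trace (A : Matrix (Fin 2) (Fin 2) R) (g : GL (Fin 2) R) :
    ((g : Matrix (Fin 2) (Fin 2) R) * A * ((g⁻¹ : GL (Fin 2) R) : Matrix _ _ R)).trace =
      A.trace := by
  rw [trace_mul_comm, ← mul_assoc, Units.inv_mul, one_mul]

theorem conj_det (A : Matrix (Fin 2) (Fin 2) R) (g : GL (Fin 2) R) :
    ((g : Matrix (Fin 2) (Fin 2) R) * A * ((g⁻¹ : GL (Fin 2) R) : Matrix _ _ R)).det = A.det := by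
  rw [det_mul_comm, ← mul_assoc, Units.inv_mul, one_mul]

variable {q : R} {ψ : AddChar R ℂ} {A : Matrix (Fin 2) (Fin 2) R} {θ : congruenceSubgroup q →* ℂ}

theorem conj_char_apply
    (hθ : ∀ n : congruenceSubgroup q,
      θ n = ψ (A * (((n : GL (Fin 2) R) : Matrix (Fin 2) (Fin 2) R) - 1)).trace)
    (g : GL (Fin 2) R) (n : congruenceSubgroup q) :
    θ.comp (MulAut.conjNormal g⁻¹ : MulAut (congruenceSubgroup q)).toMonoidHom n =
      θ n * ψ (((g : Matrix (Fin 2) (Fin 2) R) * A * ((g⁻¹ : GL (Fin 2) R) : Matrix _ _ R) - A) *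
        (((n : GL (Fin 2) R) : Matrix (Fin 2) (Fin 2) R) - 1)).trace := by
  change θ (MulAut.conjNormal g⁻¹ n) = _
  rw [hθ, hθ, conj_congruenceSubgroup_sub_one, trace_mul_conj, ← AddChar.map_add_eq_mul,
    ← trace_add, ← add_mul, add_sub_cancel]

/-- By nondegeneracy of the trace pairing, the stabilizer of the character commutes with `A` up to
what `q` annihilates. -/
theorem smul_conj_sub_eq_zero (hR : IsSquareClosedChainRing R p r) (hψ : ψ (p ^ (r - 1)) ≠ 1)
    (hq : q * q = 0)
    (hθ : ∀ n : congruenceSubgroup q,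
      θ n = ψ (A * (((n : GL (Fin 2) R) : Matrix (Fin 2) (Fin 2) R) - 1)).trace)
    {g : GL (Fin 2) R}
    (hg : θ.comp (MulAut.conjNormal g⁻¹ : MulAut (congruenceSubgroup q)).toMonoidHom = θ) :
    q • ((g : Matrix (Fin 2) (Fin 2) R) * A * ((g⁻¹ : GL (Fin 2) R) : Matrix _ _ R) - A) = 0 := by
  set C := (g : Matrix (Fin 2) (Fin 2) R) * A * ((g⁻¹ : GL (Fin 2) R) : Matrix _ _ R) - A with hC
  have key : ∀ B : Matrix (Fin 2) (Fin 2) R, ψ (q * (C * B).trace) = 1 := by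
    intro B
    obtain ⟨n, hn, -⟩ := exists_mem_congruenceSubgroup hq B
    have h1 := conj_char_apply hθ g n
    rw [hg, ← hC, hn, add_sub_cancel_left, mul_smul_comm, trace_smul, smul_eq_mul] at h1
    exact (mul_eq_left₀ (char_ne_zero θ n)).1 h1.symm
  obtain ⟨h01, h10, hd⟩ := smul_entries_of_forall_char hR hψ fun B _ => key B
  have h00 : q * C 0 0 = 0 := hR.eq_zero_of_forall_char hψ fun x => by
    rw [← key !![x, 0; 0, 0]]
    congr 1
    simp [trace_fin_two, mul_apply]
    ring
  ext i j
  rw [Matrix.smul_apply, smul_eq_mul, Matrix.zero_apply]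
  fin_cases i <;> fin_cases j
  · exact h00
  · exact h01
  · exact h10
  · exact hd.symm.trans h00

/-- An element `1 + p y A` commutes with the stabilizer of the character attached to `A` modulo the
kernel of this character. -/
theorem exists_commute_stabilizer (hR : IsSquareClosedChainRing R p r)
    (hψ : ψ (p ^ (r - 1)) ≠ 1) {l m : ℕ} (hlm : l + m = r) (hml : m ≤ l) (hlm' : l ≤ m + 1)
    {θ : congruenceSubgroup (p ^ l) →* ℂ}
    (hθ : ∀ n : congruenceSubgroup (p ^ l),
      θ n = ψ (A * (((n : GL (Fin 2) R) : Matrix (Fin 2) (Fin 2) R) - 1)).trace)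
    {c : GL (Fin 2) R} {y : R} (hc : (c : Matrix (Fin 2) (Fin 2) R) = 1 + (p * y) • A)
    {g : GL (Fin 2) R}
    (hg : θ.comp (MulAut.conjNormal g⁻¹ : MulAut (congruenceSubgroup (p ^ l))).toMonoidHom = θ) :
    ∃ n : congruenceSubgroup (p ^ l), c * g = g * c * n ∧ θ n = 1 := by
  have hq : p ^ l * p ^ l = 0 := by
    rw [← pow_add]; exact hR.pow_eq_zero_of_le (by omega)
  have hC := smul_conj_sub_eq_zero hR hψ hq hθ hg
  set F := ((g⁻¹ : GL (Fin 2) R) : Matrix (Fin 2) (Fin 2) R) * A * (g : Matrix _ _ R) - A with hF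
  have hFC : p ^ l • F = 0 := by
    have h1 : F = -(((g⁻¹ : GL (Fin 2) R) : Matrix (Fin 2) (Fin 2) R) *
        ((g : Matrix (Fin 2) (Fin 2) R) * A * ((g⁻¹ : GL (Fin 2) R) : Matrix _ _ R) - A) *
        (g : Matrix _ _ R)) := by
      rw [mul_sub, sub_mul, ← mul_assoc, ← mul_assoc, Units.inv_mul, one_mul, mul_assoc A,
        Units.inv_mul, mul_one, neg_sub]
    rw [h1, smul_neg, ← smul_mul_assoc, ← mul_smul_comm, hC, mul_zero, zero_mul, neg_zero]
  have hdvd : ∀ i j, ∃ x, F i j = p ^ m * x := fun i j =>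
    hR.pow_dvd_of_pow_mul_eq_zero (IsSquareClosedChainRing.pow_pred_ne_zero hψ) hlm.le
      (congrFun (congrFun hFC i) j)
  choose F' hF' using hdvd
  have hFF' : F = p ^ m • Matrix.of F' := by
    ext i j
    exact hF' i j
  have htr : F.trace = 0 := by
    have := conj_trace A g⁻¹
    rw [inv_inv] at this
    rw [hF, trace_sub, this, sub_self]
  -- `A` and `A + F` have equal trace and determinant, so `tr (A F) = det F`. This is divisible by
  -- `p ^ (2 * m)`, and `r ≤ 2 * m + 1`.
  have htrAF : p * (A * F).trace = 0 := by
    have h1 : (A + F).det = A.det := by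
      have := conj_det A g⁻¹
      rw [inv_inv] at this
      rw [hF, add_sub_cancel, this]
    have h2 : p * F.det = 0 := by
      rw [hFF', det_smul, Fintype.card_fin, ← mul_assoc, ← pow_mul, ← pow_succ',
        hR.pow_eq_zero_of_le (by omega), zero_mul]
    rw [trace_fin_two] at htr
    simp only [det_fin_two, Matrix.add_apply] at h1 h2
    simp only [trace_fin_two, mul_apply, Fin.sum_univ_two]
    linear_combination (-p) * h1 + h2 + p * (A 0 0 + A 1 1) * htr
  -- With the adjugate, `A * c⁻¹ * F` involves only `A * F` and `A.det • F`, whose traces are under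
  -- control.
  obtain ⟨e, he⟩ : ∃ e : R, ((c⁻¹ : GL (Fin 2) R) : Matrix (Fin 2) (Fin 2) R) =
      e • (1 + (p * y) • A.adjugate) := by
    refine ⟨((GeneralLinearGroup.det c)⁻¹ : Rˣ), ?_⟩
    have h1 : (c : Matrix (Fin 2) (Fin 2) R).adjugate = 1 + (p * y) • A.adjugate := by
      rw [hc, adjugate_fin_two, adjugate_fin_two]
      ext i j
      fin_cases i <;> fin_cases j <;> simp
    have h2 : (c : Matrix (Fin 2) (Fin 2) R) *
        (((GeneralLinearGroup.det c)⁻¹ : Rˣ) : R) • (c : Matrix (Fin 2) (Fin 2) R).adjugate = 1 := by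
      rw [mul_smul_comm, mul_adjugate, smul_smul, ← GeneralLinearGroup.val_det_apply, Units.inv_mul,
        one_smul]
    rw [← h1]
    exact (Units.inv_eq_of_mul_eq_one_right (u := c) h2)
  have hn1 : ((c⁻¹ * g⁻¹ * c * g : GL (Fin 2) R) : Matrix (Fin 2) (Fin 2) R) - 1 =
      (p * y) • (((c⁻¹ : GL (Fin 2) R) : Matrix (Fin 2) (Fin 2) R) * F) := by
    have h1 : ((g⁻¹ : GL (Fin 2) R) : Matrix (Fin 2) (Fin 2) R) * (c : Matrix (Fin 2) (Fin 2) R) *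
        (g : Matrix _ _ R) = (c : Matrix (Fin 2) (Fin 2) R) + (p * y) • F := by
      rw [hF, hc, mul_add, add_mul, mul_one, Units.inv_mul, mul_smul_comm, smul_mul_assoc, smul_sub]
      abel
    rw [Units.val_mul, Units.val_mul, Units.val_mul, mul_assoc, mul_assoc,
      ← mul_assoc _ (c : Matrix (Fin 2) (Fin 2) R), h1, mul_add, Units.inv_mul, add_sub_cancel_left,
      mul_smul_comm]
  have hmem : c⁻¹ * g⁻¹ * c * g ∈ congruenceSubgroup (p ^ l) := by
    -- The commutator minus one is a multiple of `p * F`, hence of `p ^ (m + 1)`; here `l ≤ m + 1`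
    -- is needed.
    obtain ⟨k, hk⟩ : p ^ l ∣ p ^ (m + 1) := pow_dvd_pow p hlm'
    refine ⟨(k * y) • (((c⁻¹ : GL (Fin 2) R) : Matrix (Fin 2) (Fin 2) R) * Matrix.of F'), ?_⟩
    rw [← sub_eq_iff_eq_add', hn1, hFF', mul_smul_comm, smul_smul (p * y),
      smul_smul (p ^ l)]
    congr 1
    linear_combination y * hk
  refine ⟨⟨_, hmem⟩, by group, ?_⟩
  rw [hθ, hn1, he]
  have h1 : (A * (p * y) • (e • (1 + (p * y) • A.adjugate) * F)).trace =
      e * y * (p * (A * F).trace) + e * (p * y) * (p * y) * A.det * F.trace := by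
    rw [smul_mul_assoc, smul_smul, mul_smul_comm, add_mul, one_mul, smul_mul_assoc, mul_add,
      mul_smul_comm, ← mul_assoc, mul_adjugate, smul_mul_assoc, one_mul, trace_smul, trace_add,
      trace_smul, trace_smul]
    simp only [smul_eq_mul]
    ring
  rw [h1, htrAF, htr, mul_zero, mul_zero, add_zero, AddChar.map_zero_eq_one]

theorem conj_char_eq_of_commute
    (hθ : ∀ n : congruenceSubgroup q,
      θ n = ψ (A * (((n : GL (Fin 2) R) : Matrix (Fin 2) (Fin 2) R) - 1)).trace)
    {c : GL (Fin 2) R} (hc : (c : Matrix (Fin 2) (Fin 2) R) * A = A * c) :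
    θ.comp (MulAut.conjNormal c⁻¹ : MulAut (congruenceSubgroup q)).toMonoidHom = θ := by
  ext n
  rw [conj_char_apply hθ, hc, mul_assoc, Units.mul_inv, mul_one, sub_self, zero_mul, trace_zero,
    AddChar.map_zero_eq_one, mul_one]

end CharactersOfCongruenceSubgroups

/-! ### Constraints on the characters that twist `ρ` to itself -/

section Twists

variable {R : Type*} [CommRing R] {V : Type*} [AddCommGroup V] [Module ℂ V]
  {ρ : Representation ℂ (GL (Fin 2) R) V} {χ : Rˣ →* ℂ} {T : V →ₗ[ℂ] V}

/-- The scalar matrix `u` is central, so it acts by a nonzero scalar, and its determinant is `u *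
u`. -/
theorem IsTwist.apply_mul_self [Finite R] (hρ : ρ.IsIrreducible)
    (hT : IsTwist ρ (χ.comp GeneralLinearGroup.det) T) (hT0 : T ≠ 0) (u : Rˣ) :
    χ (u * u) = 1 := by
  set z : GL (Fin 2) R := GeneralLinearGroup.scalar (Fin 2) u with hz
  have hcomm : ∀ g, g * z = z * g := fun g => (GeneralLinearGroup.scalar_commute u g).symm
  have hdet : GeneralLinearGroup.det z = u * u := by
    ext
    rw [GeneralLinearGroup.val_det_apply]
    simp [hz, GeneralLinearGroup.scalar, sq]
  obtain ⟨a, ha⟩ := exists_eq_smul_of_commute hρ (ρ z) fun g v => by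
    rw [← rep_mul_apply, ← rep_mul_apply, hcomm]
  obtain ⟨v, hv⟩ : ∃ v, T v ≠ 0 := by
    by_contra! h
    exact hT0 (LinearMap.ext h)
  have h1 := hT z v
  rw [MonoidHom.comp_apply, hdet, ha, ha, map_smul, smul_smul] at h1
  have ha0 : a ≠ 0 := by
    rintro rfl
    have h2 := congrArg (ρ z⁻¹) (ha (T v))
    rw [← rep_mul_apply, zero_smul, map_zero, inv_mul_cancel, map_one] at h2
    exact hv h2
  have h2 : (1 - χ (u * u)) * a = 0 := by
    refine (smul_eq_zero.1 (?_ : _ • T v = 0)).resolve_right hv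
    rw [sub_mul, one_mul, sub_smul, ← h1, sub_self]
  exact (sub_eq_zero.1 ((mul_eq_zero.1 h2).resolve_right ha0)).symm

variable [Nontrivial R] {p : R} {r : ℕ}

theorem char_eq_one_of_forall (hR : IsSquareClosedChainRing R p r)
    (hsq : ∀ u : Rˣ, χ (u * u) = 1) (h : ∀ (u : Rˣ) (w : R), (u : R) = 1 + p * w → χ u = 1) :
    χ = 1 := by
  ext u
  obtain ⟨s, v, w, rfl, hv⟩ := hR.exists_eq_sq_mul u
  rw [map_mul, hsq, h v w hv, one_mul, MonoidHom.one_apply]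

variable {ψ : AddChar R ℂ} {A : Matrix (Fin 2) (Fin 2) R} {l m : ℕ}
  {θ : congruenceSubgroup (p ^ l) →* ℂ} {v : V}

/-- A twist that is trivial on the determinants of the congruence subgroup is trivial. -/
theorem IsTwist.eq_one_of_forall [Finite R] (hR : IsSquareClosedChainRing R p r)
    (hψ : ψ (p ^ (r - 1)) ≠ 1) (hlm : l + m = r) (hml : m ≤ l) (hlm' : l ≤ m + 1)
    (hθ : ∀ n : congruenceSubgroup (p ^ l),
      θ n = ψ (A * (((n : GL (Fin 2) R) : Matrix (Fin 2) (Fin 2) R) - 1)).trace)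
    (ht : IsUnit A.trace) (hρ : ρ.IsIrreducible) (hv : v ∈ charEigenspace ρ θ) (hv0 : v ≠ 0)
    (hT : IsTwist ρ (χ.comp GeneralLinearGroup.det) T) (hT0 : T ≠ 0)
    (hχ : ∀ (u : Rˣ) (x : R), (u : R) = 1 + p ^ l * x → χ u = 1) : χ = 1 := by
  have hq : p ^ l * p ^ l = 0 := by
    rw [← pow_add]; exact hR.pow_eq_zero_of_le (by omega)
  refine char_eq_one_of_forall hR (hT.apply_mul_self hρ hT0) fun u w hu => ?_
  obtain ⟨y, hy⟩ := hR.exists_mul_add_eq ht A.det w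
  have hdet : (1 + (p * y) • A).det = u := by
    rw [det_one_add_smul_fin_two, hu]
    linear_combination p * hy
  obtain ⟨c, hc⟩ : ∃ c : GL (Fin 2) R, (c : Matrix (Fin 2) (Fin 2) R) = 1 + (p * y) • A :=
    ⟨GeneralLinearGroup.mk'' _ (hdet ▸ u.isUnit), rfl⟩
  have hcu : GeneralLinearGroup.det c = u := by
    ext
    rw [GeneralLinearGroup.val_det_apply, hc, hdet]
  have h1 := hT.apply_eq_one (N := congruenceSubgroup (p ^ l)) hρ hT0 hv hv0 (fun n => ?_) (c := c)
    (conj_char_eq_of_commute hθ ?_) fun g hg =>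
      exists_commute_stabilizer hR hψ hlm hml hlm' hθ hc hg
  · rwa [MonoidHom.comp_apply, hcu] at h1
  · obtain ⟨B, hB⟩ := n.2
    refine hχ _ B.trace ?_
    rw [GeneralLinearGroup.val_det_apply, hB, det_one_add_smul_fin_two, hq, zero_mul, add_zero]
  · rw [hc, add_mul, mul_add, one_mul, mul_one, smul_mul_assoc, mul_smul_comm]

variable [CharP R 2]

/-- A twist of a representation lying over the character attached to `A` restricts on `1 + p ^ l R`
either to the trivial character or to the character attached to the trace of `A`. -/
theorem IsTwist.apply_one_add [Finite R] (hR : IsSquareClosedChainRing R p r)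
    (hψ : ψ (p ^ (r - 1)) ≠ 1) (hl : r ≤ 2 * l)
    (hθ : ∀ n : congruenceSubgroup (p ^ l),
      θ n = ψ (A * (((n : GL (Fin 2) R) : Matrix (Fin 2) (Fin 2) R) - 1)).trace)
    (ht : IsUnit A.trace) (hρ : ρ.IsIrreducible) (hv : v ∈ charEigenspace ρ θ) (hv0 : v ≠ 0)
    (hT : IsTwist ρ (χ.comp GeneralLinearGroup.det) T) (hT0 : T ≠ 0) :
    (∀ (u : Rˣ) (x : R), (u : R) = 1 + p ^ l * x → χ u = 1) ∨
    (∀ (u : Rˣ) (x : R), (u : R) = 1 + p ^ l * x → χ u = ψ (p ^ l * (A.trace * x))) := by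
  have hq : p ^ l * p ^ l = 0 := by
    rw [← pow_add]; exact hR.pow_eq_zero_of_le (by omega)
  -- `T v` is an eigenvector for the twisted character, which is therefore conjugate to `θ`.
  obtain ⟨g, hg⟩ := exists_conj_eq_of_mem_charEigenspace hρ hv hv0
    (hT.apply_mem_charEigenspace hv)
    (fun h => hv0 (hT.injective hρ hT0 (h.trans (map_zero T).symm)))
  set C := (g : Matrix (Fin 2) (Fin 2) R) * A * ((g⁻¹ : GL (Fin 2) R) : Matrix _ _ R) - A with hC
  have key : ∀ (B : Matrix (Fin 2) (Fin 2) R) (u : Rˣ), (u : R) = 1 + p ^ l * B.trace →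
      χ u = ψ (p ^ l * (C * B).trace) := by
    intro B u hu
    obtain ⟨n, hn, hdet⟩ := exists_mem_congruenceSubgroup hq B
    have h1 := conj_char_apply hθ g n
    rw [← hg, ← hC, hn, add_sub_cancel_left, mul_smul_comm, trace_smul, smul_eq_mul, mul_comm] at h1
    change θ n * χ (GeneralLinearGroup.det (n : GL (Fin 2) R)) = _ at h1
    rw [← mul_left_cancel₀ (char_ne_zero θ n) h1]
    congr 1
    ext
    rw [hu, hdet]
  obtain ⟨h01, h10, hd⟩ := smul_entries_of_forall_char hR hψ (q := p ^ l) (C := C) fun B hB => by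
    rw [← key B 1 (by simp [hB]), map_one]
  have hdet : (A + C).det = A.det := by rw [hC, add_sub_cancel, conj_det]
  -- Up to the factor `p ^ l`, `C` is a scalar `c`, and `det (A + c) = det A` reads `c * (A.trace +
  -- c) = 0`.
  have hc : p ^ l * (C 0 0 * (A.trace + C 0 0)) = 0 := by
    simp only [det_fin_two, Matrix.add_apply] at hdet
    rw [trace_fin_two]
    linear_combination p ^ l * hdet + A 0 1 * h10 + (A 1 0 + C 1 0) * h01 + (A 0 0 + C 0 0) * hd
  have hψC : ∀ (u : Rˣ) (x : R), (u : R) = 1 + p ^ l * x → χ u = ψ (p ^ l * C 0 0 * x) := by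
    intro u x hu
    rw [key !![x, 0; 0, 0] u (by rw [hu]; simp [trace_fin_two])]
    congr 1
    simp [trace_fin_two, mul_apply]
    ring
  -- Since `A.trace` is a unit, one of the two factors is a unit and cancels. The sign in `c =
  -- -A.trace` disappears in characteristic 2.
  rcases hR.isUnit_or_dvd (C 0 0) with h | ⟨y, hy⟩
  · right
    intro u x hu
    have h1 : p ^ l * (A.trace + C 0 0) = 0 := by
      refine h.mul_left_eq_zero.1 ?_
      rw [← hc]
      ring
    rw [hψC u x hu]
    congr 1
    linear_combination x * h1 - p ^ l * A.trace * x * CharTwo.two_eq_zero (R := R)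
  · left
    intro u x hu
    have h1 : IsUnit (A.trace + C 0 0) := hy ▸ hR.isUnit_add_mul ht y
    have h2 : p ^ l * C 0 0 = 0 := h1.mul_left_eq_zero.1 (by rw [← hc]; ring)
    rw [hψC u x hu, h2, zero_mul, AddChar.map_zero_eq_one]

/-- In characteristic 2, `(1 + y)² = 1 + y²`, on which `χ` is trivial; `y` is a multiple of `p`, so
`1 + y` is a unit. -/
theorem char_trace_mul_sq_eq_one (hR : IsSquareClosedChainRing R p r) (hl : 1 ≤ l) {t : R}
    (hsq : ∀ u : Rˣ, χ (u * u) = 1)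
    (hχ : ∀ (u : Rˣ) (x : R), (u : R) = 1 + p ^ l * x → χ u = ψ (p ^ l * (t * x)))
    {y : R} (hy : p ^ l ∣ y ^ 2) : ψ (t * y ^ 2) = 1 := by
  obtain ⟨x, hx⟩ := hy
  have hpy : p ∣ y := by
    refine (hR.isUnit_or_dvd y).resolve_left fun h => hR.not_dvd_of_isUnit (h.pow 2) ?_
    rw [hx]
    exact (dvd_pow_self p (by omega)).mul_right x
  obtain ⟨y, rfl⟩ := hpy
  obtain ⟨u, hu⟩ := hR.isUnit_add_mul isUnit_one y
  have h1 := hχ (u * u) x (by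
    rw [Units.val_mul, hu]
    linear_combination hx + p * y * CharTwo.two_eq_zero (R := R))
  rw [hsq] at h1
  rw [hx, h1]
  congr 1
  ring

/-- As `r - 1 = 2 * m`, a suitable `y = p ^ m * z` makes `t * y²` equal to `p ^ (r - 1)`. -/
theorem false_of_char_trace_odd (hR : IsSquareClosedChainRing R p r)
    (hψ : ψ (p ^ (r - 1)) ≠ 1) {t : R} (ht : IsUnit t) (hm : 1 ≤ m) (hrm : r = 2 * m + 1)
    (hsq : ∀ u : Rˣ, χ (u * u) = 1)
    (hχ : ∀ (u : Rˣ) (x : R), (u : R) = 1 + p ^ (m + 1) * x →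
      χ u = ψ (p ^ (m + 1) * (t * x))) : False := by
  obtain ⟨z, hz⟩ := hR.exists_pow_pred_mul (by omega) ht
  have h1 : (p ^ m * z) ^ 2 = p ^ (r - 1) * z ^ 2 := by
    rw [mul_pow, ← pow_mul]
    congr 2
    omega
  have h2 := char_trace_mul_sq_eq_one hR (by omega) hsq hχ (y := p ^ m * z) (by
    rw [h1]
    exact (pow_dvd_pow p (by omega)).mul_right _)
  refine hψ ?_
  rw [← hz, ← h2, h1]
  congr 1
  ring

/-- The square approximation improves one power of `p` at a time. At even `k` the leading term is
itself a square modulo `p ^ (k + 1)` and is absorbed, squaring being additive. At odd `k` a unit `s`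
would force `ψ (p ^ (r - 1)) = 1`, since normalization removes the contribution of `a²`. -/
theorem exists_eq_sq_add_of_char_trace (hR : IsSquareClosedChainRing R p r)
    (hψ : ψ (p ^ (r - 1)) ≠ 1) (hr : r = 2 * l) {t : R}
    (hnorm : ∀ y : R, p ^ l ∣ y ^ 2 → ψ (y ^ 2) = 1)
    (hsq : ∀ u : Rˣ, χ (u * u) = 1)
    (hχ : ∀ (u : Rˣ) (x : R), (u : R) = 1 + p ^ l * x → χ u = ψ (p ^ l * (t * x))) :
    ∀ k ≤ l, ∃ a s, t = a ^ 2 + p ^ k * s := by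
  intro k
  induction k with
  | zero => exact fun _ => ⟨0, t, by ring⟩
  | succ k ih =>
    intro hk
    obtain ⟨a, s, hs⟩ := ih (by omega)
    rcases Nat.even_or_odd' k with ⟨j, rfl | rfl⟩
    · obtain ⟨z, w, hw⟩ := hR.exists_dvd_sub_sq s
      refine ⟨a + p ^ j * z, w, ?_⟩
      rw [hs]
      linear_combination p ^ (2 * j) * hw - a * p ^ j * z * CharTwo.two_eq_zero (R := R)
    · rcases hR.isUnit_or_dvd s with h | ⟨w, hw⟩
      · exfalso
        obtain ⟨z, hz⟩ := hR.exists_pow_pred_mul (by omega) h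
        -- Multiplying by `(p ^ i * z)²` moves the odd term to level `r - 1`, also odd; `k < l`
        -- ensures `l ≤ 2 * i`.
        obtain ⟨i, hi⟩ : ∃ i, r - 1 = 2 * i + (2 * j + 1) := ⟨l - 1 - j, by omega⟩
        have h1 : p ^ l ∣ (p ^ i * z) ^ 2 := by
          rw [mul_pow, ← pow_mul]
          exact (pow_dvd_pow p (by omega)).mul_right _
        have h2 := char_trace_mul_sq_eq_one hR (by omega) hsq hχ h1
        have h3 := hnorm (a * (p ^ i * z)) (by rw [mul_pow]; exact h1.mul_left _)
        have h4 : t * (p ^ i * z) ^ 2 = (a * (p ^ i * z)) ^ 2 + p ^ (r - 1) := by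
          rw [← hz, hs, hi]
          ring
        rw [h4, AddChar.map_add_eq_mul, h3, one_mul] at h2
        exact hψ h2
      · exact ⟨a, w, by rw [hs, hw]; ring⟩

end Twists

/-! ### Restriction to SL₂ over the finite quotient -/

section Restriction

theorem det_eq_one_iff_exists_toGL {R : Type*} [CommRing R] (g : GL (Fin 2) R) :
    GeneralLinearGroup.det g = 1 ↔ ∃ s : SpecialLinearGroup (Fin 2) R,
      SpecialLinearGroup.toGL s = g := by
  constructor
  · intro h
    refine ⟨⟨g, ?_⟩, Units.ext rfl⟩
    rw [← GeneralLinearGroup.val_det_apply, h, Units.val_one]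
  · rintro ⟨s, rfl⟩
    ext
    rw [GeneralLinearGroup.val_det_apply]
    exact s.2

variable {R : Type*} [CommRing R] [Finite R] [Nontrivial R] [CharP R 2]
  {V : Type*} [AddCommGroup V] [Module ℂ V]
  {ρ : Representation ℂ (GL (Fin 2) R) V} {p : R} {r l m : ℕ} {ψ : AddChar R ℂ}
  {A : Matrix (Fin 2) (Fin 2) R} {θ : congruenceSubgroup (p ^ l) →* ℂ} {v : V}

theorem resSL_isIrreducible_of_odd (hR : IsSquareClosedChainRing R p r)
    (hψ : ψ (p ^ (r - 1)) ≠ 1) (hm : 1 ≤ m) (hrm : r = 2 * m + 1)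
    {θ : congruenceSubgroup (p ^ (m + 1)) →* ℂ}
    (hθ : ∀ n : congruenceSubgroup (p ^ (m + 1)),
      θ n = ψ (A * (((n : GL (Fin 2) R) : Matrix (Fin 2) (Fin 2) R) - 1)).trace)
    (ht : IsUnit A.trace) (hρ : ρ.IsIrreducible) (hv : v ∈ charEigenspace ρ θ) (hv0 : v ≠ 0) :
    (resSL ρ).IsIrreducible := by
  refine isIrreducible_comp_of_forall_twist GeneralLinearGroup.det SpecialLinearGroup.toGL
    (fun g => (det_eq_one_iff_exists_toGL g).1) hρ fun χ T hT hT0 => ?_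
  rcases hT.apply_one_add hR hψ (by omega) hθ ht hρ hv hv0 hT0 with h | h
  · exact hT.eq_one_of_forall hR hψ (m := m) (by omega) (by omega) le_rfl hθ ht hρ hv hv0 hT0 h
  · exact (false_of_char_trace_odd hR hψ ht hm hrm (hT.apply_mul_self hρ hT0) h).elim

theorem resSL_isIrreducible_of_even (hR : IsSquareClosedChainRing R p r)
    (hψ : ψ (p ^ (r - 1)) ≠ 1) (hr : r = 2 * l)
    (hθ : ∀ n : congruenceSubgroup (p ^ l),
      θ n = ψ (A * (((n : GL (Fin 2) R) : Matrix (Fin 2) (Fin 2) R) - 1)).trace)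
    (ht : IsUnit A.trace) (hρ : ρ.IsIrreducible) (hv : v ∈ charEigenspace ρ θ) (hv0 : v ≠ 0)
    (hnorm : ∀ y : R, p ^ l ∣ y ^ 2 → ψ (y ^ 2) = 1)
    (hA : ¬ ∃ a s, A.trace = a ^ 2 + p ^ l * s) :
    (resSL ρ).IsIrreducible := by
  refine isIrreducible_comp_of_forall_twist GeneralLinearGroup.det SpecialLinearGroup.toGL
    (fun g => (det_eq_one_iff_exists_toGL g).1) hρ fun χ T hT hT0 => ?_
  rcases hT.apply_one_add hR hψ (by omega) hθ ht hρ hv hv0 hT0 with h | h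
  · exact hT.eq_one_of_forall hR hψ (m := l) (by omega) (by omega) (by omega) hθ ht hρ hv hv0 hT0 h
  · exact (hA (exists_eq_sq_add_of_char_trace hR hψ hr hnorm (hT.apply_mul_self hρ hT0) h l
      le_rfl)).elim

theorem resSL_isIrreducible_or_sum_of_even (hR : IsSquareClosedChainRing R p r)
    (hψ : ψ (p ^ (r - 1)) ≠ 1) (hr : r = 2 * l)
    (hθ : ∀ n : congruenceSubgroup (p ^ l),
      θ n = ψ (A * (((n : GL (Fin 2) R) : Matrix (Fin 2) (Fin 2) R) - 1)).trace)
    (ht : IsUnit A.trace) (hρ : ρ.IsIrreducible) (hv : v ∈ charEigenspace ρ θ) (hv0 : v ≠ 0) :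
    (resSL ρ).IsIrreducible ∨ IsSumOfTwoIrreduciblesOfHalfDim (resSL ρ) := by
  have hone : ∀ (χ : Rˣ →* ℂ) (T : V →ₗ[ℂ] V), IsTwist ρ (χ.comp GeneralLinearGroup.det) T →
      T ≠ 0 → (∀ (u : Rˣ) (x : R), (u : R) = 1 + p ^ l * x → χ u = 1) → χ = 1 :=
    fun χ T hT hT0 h => hT.eq_one_of_forall hR hψ (m := l) (by omega) (by omega) (by omega) hθ ht
      hρ hv hv0 hT0 h
  refine isIrreducible_or_sum_comp_of_forall_twist GeneralLinearGroup.det SpecialLinearGroup.toGL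
    GeneralLinearGroup.det_surjective det_eq_one_iff_exists_toGL hρ
    (fun χ T hT hT0 => MonoidHom.ext fun u => ?_) ?_
  · rw [MonoidHom.mul_apply, ← map_mul, hT.apply_mul_self hρ hT0, MonoidHom.one_apply]
  intro χ χ' T T' hT hT0 hT' hT0' hχ hχ'
  have h := (hT.apply_one_add hR hψ (by omega) hθ ht hρ hv hv0 hT0).resolve_left
    fun h => hχ (hone χ T hT hT0 h)
  have h' := (hT'.apply_one_add hR hψ (by omega) hθ ht hρ hv hv0 hT0').resolve_left
    fun h => hχ' (hone χ' T' hT' hT0' h)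
  have hTT : T ∘ₗ T' ≠ 0 := by
    intro h0
    refine hT0' (LinearMap.ext fun w => hT.injective hρ hT0 ?_)
    rw [LinearMap.zero_apply, map_zero]
    exact LinearMap.congr_fun h0 w
  -- Both characters are `ψ (p ^ l * (A.trace * x))` on `1 + p ^ l R`, so their product is trivial
  -- there, hence everywhere.
  have hmul : χ * χ' = 1 := by
    refine hone _ (T ∘ₗ T') (by rw [MonoidHom.mul_comp]; exact hT.comp hT') hTT fun u x hu => ?_
    rw [MonoidHom.mul_apply, h u x hu, h' u x hu, ← AddChar.map_add_eq_mul,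
      CharTwo.add_self_eq_zero, AddChar.map_zero_eq_one]
  ext u
  have h1 := DFunLike.congr_fun hmul u
  have h2 := hT'.apply_mul_self hρ hT0' u
  rw [MonoidHom.mul_apply, MonoidHom.one_apply] at h1
  rw [map_mul] at h2
  exact mul_right_cancel₀ (char_ne_zero χ' u) (h1.trans h2.symm)

end Restriction

/-! ### Quotients of the valuation ring, and normalized characters -/

section QuotPow

variable {𝔬 : Type*} [CommRing 𝔬] [IsLocalRing 𝔬]

theorem finite_quotPow [TopologicalSpace 𝔬] (h_adic : IsAdic (maximalIdeal 𝔬)) [CompactSpace 𝔬]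
    (n : ℕ) : Finite (QuotPow 𝔬 n) := by
  have hna : NonarchimedeanRing 𝔬 := by
    rw [IsAdic] at h_adic
    subst h_adic
    exact Ideal.nonarchimedean _
  exact AddSubgroup.quotient_finite_of_isOpen (maximalIdeal 𝔬 ^ n).toAddSubgroup
    ((isAdic_iff.1 h_adic).1 n)

theorem nontrivial_quotPow {n : ℕ} (hn : n ≠ 0) : Nontrivial (QuotPow 𝔬 n) :=
  Ideal.Quotient.nontrivial_iff.2 fun h =>
    (maximalIdeal.isMaximal 𝔬).ne_top (eq_top_iff.2 (h ▸ Ideal.pow_le_self hn))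

theorem charP_two_quotPow [CharP 𝔬 2] {n : ℕ} (hn : n ≠ 0) : CharP (QuotPow 𝔬 n) 2 := by
  have := nontrivial_quotPow (𝔬 := 𝔬) hn
  refine CharTwo.of_one_ne_zero_of_two_eq_zero one_ne_zero ?_
  rw [← map_ofNat (Ideal.Quotient.mk (maximalIdeal 𝔬 ^ n)) 2, CharTwo.two_eq_zero, map_zero]

/-- Every element of the ring is a square modulo the maximal ideal, if the residue field is finite
of characteristic two. -/
theorem exists_sub_sq_mem_maximalIdeal [CharP 𝔬 2] [Finite (𝔬 ⧸ maximalIdeal 𝔬)] (x : 𝔬) :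
    ∃ z, x - z ^ 2 ∈ maximalIdeal 𝔬 := by
  have : CharP (𝔬 ⧸ maximalIdeal 𝔬) 2 := by
    refine CharTwo.of_one_ne_zero_of_two_eq_zero one_ne_zero ?_
    rw [← map_ofNat (Ideal.Quotient.mk (maximalIdeal 𝔬)) 2, CharTwo.two_eq_zero, map_zero]
  have : ExpChar (𝔬 ⧸ maximalIdeal 𝔬) 2 := .prime Nat.prime_two
  obtain ⟨z, hz⟩ := (bijective_frobenius (𝔬 ⧸ maximalIdeal 𝔬) 2).2 (Ideal.Quotient.mk _ x)
  obtain ⟨z, rfl⟩ := Ideal.Quotient.mk_surjective z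
  refine ⟨z, ?_⟩
  rw [← Ideal.Quotient.eq, ← hz, frobenius_def, map_pow]

end QuotPow

section DiscreteValuationRing

variable {𝔬 : Type*} [CommRing 𝔬] [IsDomain 𝔬] [IsDiscreteValuationRing 𝔬]

theorem isSquareClosedChainRing_quotPow [CharP 𝔬 2] [Finite (𝔬 ⧸ maximalIdeal 𝔬)] {π : 𝔬}
    (hπ : Irreducible π) (r : ℕ) : IsSquareClosedChainRing (QuotPow 𝔬 r) (toQuotPow r π) r := by
  have hmem : ∀ x : 𝔬, x ∈ maximalIdeal 𝔬 → toQuotPow r π ∣ toQuotPow r x := by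
    intro x hx
    rw [hπ.maximalIdeal_eq, Ideal.mem_span_singleton] at hx
    exact map_dvd _ hx
  refine ⟨fun x => ?_, toQuotPow_pow_eq_zero le_rfl hπ, fun x => ?_⟩
  · obtain ⟨x, rfl⟩ := Ideal.Quotient.mk_surjective x
    by_cases hx : IsUnit x
    · exact Or.inl (hx.map _)
    · exact Or.inr (hmem x ((mem_maximalIdeal x).2 hx))
  · obtain ⟨x, rfl⟩ := Ideal.Quotient.mk_surjective x
    obtain ⟨z, hz⟩ := exists_sub_sq_mem_maximalIdeal x
    exact ⟨toQuotPow r z, by simpa using hmem _ hz⟩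

/-- Changing `π ^ (r - 1)` modulo `π ^ r` keeps its valuation `r - 1`, which is odd, while squares
have even valuation. -/
theorem not_odd_pow_eq_sq {π : 𝔬} (hπ : Irreducible π) {r : ℕ} (hr : Even r) (hr0 : r ≠ 0)
    (y : QuotPow 𝔬 r) : toQuotPow r π ^ (r - 1) ≠ y ^ 2 := by
  obtain ⟨y, rfl⟩ := Ideal.Quotient.mk_surjective y
  intro h
  rw [← map_pow, ← map_pow, Ideal.Quotient.eq, hπ.maximalIdeal_eq, Ideal.span_singleton_pow,
    Ideal.mem_span_singleton] at h
  obtain ⟨z, hz⟩ := h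
  obtain ⟨k, rfl⟩ := hr
  have hy : y ^ 2 = π ^ (k + k - 1) * (1 - π * z) := by
    have : π ^ (k + k) = π ^ (k + k - 1) * π := by
      rw [← pow_succ]
      congr 1
      omega
    linear_combination (-1 : 𝔬) * hz - z * this
  have hu : IsUnit (1 - π * z) := by
    by_contra h
    refine (maximalIdeal.isMaximal 𝔬).ne_top ((Ideal.eq_top_iff_one _).2 ?_)
    have h1 : π * z ∈ maximalIdeal 𝔬 :=
      Ideal.mul_mem_right _ _ ((mem_maximalIdeal π).2 hπ.not_isUnit)
    simpa using add_mem ((mem_maximalIdeal _).2 h) h1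
  have h1 := congrArg (IsDiscreteValuationRing.addVal 𝔬) hy
  rw [IsDiscreteValuationRing.addVal_pow, IsDiscreteValuationRing.addVal_mul, hπ.addVal_pow,
    IsDiscreteValuationRing.addVal_eq_zero_iff.2 hu, add_zero] at h1
  cases hv : IsDiscreteValuationRing.addVal 𝔬 y with
  | top =>
    rw [hv, two_nsmul, top_add] at h1
    exact ENat.natCast_ne_top _ h1.symm
  | coe n =>
    rw [hv, nsmul_eq_mul] at h1
    have h2 : 2 * n = k + k - 1 := by exact_mod_cast h1
    omega

/-- In characteristic 2 the squares form an additive subgroup, which misses `π ^ (r - 1)`. A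
character of the quotient separating this element is trivial on all squares. -/
theorem exists_isNormalizedChar [CharP 𝔬 2] {π : 𝔬} (hπ : Irreducible π) {r : ℕ} (hr : Even r)
    (hr0 : r ≠ 0) [Finite (QuotPow 𝔬 r)] :
    ∃ ψ : AddChar (QuotPow 𝔬 r) ℂ, ψ (toQuotPow r π ^ (r - 1)) ≠ 1 ∧ IsNormalizedChar r π ψ := by
  have := charP_two_quotPow (𝔬 := 𝔬) hr0
  let S : AddSubgroup (QuotPow 𝔬 r) :=
    { carrier := {x | ∃ y, x = y ^ 2}
      add_mem' := by
        rintro _ _ ⟨y, rfl⟩ ⟨z, rfl⟩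
        exact ⟨y + z, (CharTwo.add_sq y z).symm⟩
      zero_mem' := ⟨0, by simp⟩
      neg_mem' := by
        rintro _ ⟨y, rfl⟩
        exact ⟨y, CharTwo.neg_eq _⟩ }
  have hS : (QuotientAddGroup.mk' S (toQuotPow r π ^ (r - 1))) ≠ 0 := by
    intro h
    obtain ⟨y, hy⟩ := (QuotientAddGroup.eq_zero_iff _).1 h
    exact not_odd_pow_eq_sq hπ hr hr0 y hy
  obtain ⟨φ, hφ⟩ := AddChar.exists_apply_ne_zero.2 hS
  refine ⟨φ.compAddMonoidHom (QuotientAddGroup.mk' S), hφ, fun y _ => ?_⟩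
  have : QuotientAddGroup.mk' S (y ^ 2) = 0 := (QuotientAddGroup.eq_zero_iff _).2 ⟨y, rfl⟩
  rw [AddChar.compAddMonoidHom_apply, this, AddChar.map_zero_eq_one]

end DiscreteValuationRing

theorem theorem1p3 {𝔬 : Type*} [CommRing 𝔬] [IsDomain 𝔬] [IsDiscreteValuationRing 𝔬]
    [CharP 𝔬 2] [TopologicalSpace 𝔬] (h_adic : IsAdic (maximalIdeal 𝔬)) [CompactSpace 𝔬]
    (π : 𝔬) (hπ : Irreducible π) (r : ℕ) (hr : 2 ≤ r) :
    (Even r → ∃ ψ : AddChar (QuotPow 𝔬 r) ℂ, ψ (toQuotPow r π ^ (r - 1)) ≠ 1 ∧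
      IsNormalizedChar r π ψ) ∧
    ∀ (ψ : AddChar (QuotPow 𝔬 r) ℂ), ψ (toQuotPow r π ^ (r - 1)) ≠ 1 →
    ∀ (A : Matrix (Fin 2) (Fin 2) (QuotPow 𝔬 (r / 2))), IsCyclicMatrix A → IsUnit A.trace →
    ∀ {V : Type*} [AddCommGroup V] [Module ℂ V]
      (ρ : Representation ℂ (GL (Fin 2) (QuotPow 𝔬 r)) V),
    IsIrrOver (charRep (psiA r π hπ ψ A)) ρ →
      (Odd r → (resSL ρ).IsIrreducible) ∧
      (Even r → IsNormalizedChar r π ψ → ¬ IsSquare A.trace → (resSL ρ).IsIrreducible) ∧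
      (Even r → IsSquare A.trace →
        (resSL ρ).IsIrreducible ∨ IsSumOfTwoIrreduciblesOfHalfDim (resSL ρ)) := by
  have hfin : Finite (QuotPow 𝔬 r) := finite_quotPow h_adic r
  have hfin' : Finite (𝔬 ⧸ maximalIdeal 𝔬) :=
    Finite.of_surjective _
      (Ideal.Quotient.factor_surjective (Ideal.pow_le_self (by omega : r ≠ 0)))
  have hnt : Nontrivial (QuotPow 𝔬 r) := nontrivial_quotPow (by omega)
  have hnt' : Nontrivial (QuotPow 𝔬 (r / 2)) := nontrivial_quotPow (by omega)
  have hchar : CharP (QuotPow 𝔬 r) 2 := charP_two_quotPow (by omega)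
  refine ⟨fun h => exists_isNormalizedChar hπ h (by omega), ?_⟩
  intro ψ hψ A _ hA V _ _ ρ hρ
  have hR := isSquareClosedChainRing_quotPow hπ r
  obtain ⟨v, hv0, hv⟩ := hρ.exists_eigenvector
  have hθ : ∀ n, psiA r π hπ ψ A n = ψ (liftMatrix r A *
      (((n : GL (Fin 2) (QuotPow 𝔬 r)) : Matrix (Fin 2) (Fin 2) (QuotPow 𝔬 r)) - 1)).trace :=
    fun _ => rfl
  let f := Ideal.Quotient.factor (Ideal.pow_le_pow_right (I := maximalIdeal 𝔬)
    (Nat.div_le_self r 2))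
  have htr : f (liftMatrix r A).trace = A.trace := by
    conv_rhs => rw [← reduceMatrix_liftMatrix r A]
    simp [trace_fin_two, reduceMatrix, f]
  have hfπ : f (toQuotPow r π) ^ (r / 2) = 0 := toQuotPow_pow_eq_zero le_rfl hπ
  have ht : IsUnit (liftMatrix r A).trace := by
    refine (hR.isUnit_or_dvd _).resolve_right fun h => ?_
    have h1 := map_dvd f h
    rw [htr] at h1
    have h2 := (isUnit_of_dvd_unit h1 hA).pow (r / 2)
    rw [hfπ] at h2
    exact not_isUnit_zero h2
  refine ⟨fun ho => ?_, fun he hnorm hns => ?_, fun he _ => ?_⟩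
  · obtain ⟨m, hm⟩ := ho
    have hl : (r + 1) / 2 = m + 1 := by omega
    -- The domain of the character depends on `(r + 1) / 2`, so the character is abstracted before
    -- rewriting the exponent.
    generalize psiA r π hπ ψ A = θ at hv hθ
    revert θ
    rw [hl]
    intro θ hv hθ
    exact resSL_isIrreducible_of_odd hR hψ (by omega) hm hθ ht hρ.1 hv hv0
  · have hl : (r + 1) / 2 = r / 2 := by
      obtain ⟨k, hk⟩ := he
      omega
    refine resSL_isIrreducible_of_even (l := (r + 1) / 2) hR hψ ?_ hθ ht hρ.1 hv hv0 ?_ ?_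
    · obtain ⟨k, hk⟩ := he
      omega
    · rw [hl]
      exact hnorm
    · rintro ⟨a, s, h⟩
      -- For even `r` the exponents `ℓ` and `ℓ'` agree, so reduction kills the error term `p ^ ℓ *
      -- s`.
      refine hns ⟨f a, ?_⟩
      rw [← htr, h, map_add, map_mul, map_pow, map_pow, hl, hfπ, zero_mul, add_zero, sq]
  · refine resSL_isIrreducible_or_sum_of_even (l := (r + 1) / 2) hR hψ ?_ hθ ht hρ.1 hv hv0
    obtain ⟨k, hk⟩ := he
    omega
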